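/- For $n\in\mathbb Z$ and $t\in\mathbb R$ let $$J_n(t)=\frac{i^n}{2\pi}\int_0^{2\pi}e^{ink-it\cos k}\,dk$$ be the Bessel function of the first kind of integer order $n$, and for $\nu\in\mathbb C$ and $z\in\mathbb C\setminus\{0\}$ let $$J_\nu(z)=\Bigl(\frac z2\Bigr)^{\nu}\sum_{m=0}^\infty\frac{(-1)^m}{m!\,\Gamma(m+\nu+1)}\Bigl(\frac z2\Bigr)^{2m}$$ (principal branch of the power; $1/\Gamma=0$ at the poles of $\Gamma$) be the Bessel function of the first kind of order $\nu$. Then: 1. For every integer $n$ and every real $t$ with $|t|\ge 1$, $$|J_n(t)|\le\frac{1}{|t|^{1/4}\bigl(|n|^{1/3}+\bigl||t|-|n|\bigr|\bigr)^{1/4}}.$$ 2. The same estimate holds for non-integer orders at least $1$: for every real $\nu\ge 1$ and every real $t$ with $|t|\ge1$, $$|J_\nu(t)|\le\frac{1}{|t|^{1/4}\bigl(|\nu|^{1/3}+\bigl||t|-|\nu|\bigr|\bigr)^{1/4}}.$$ -/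

import Mathlib

/-- The Bessel function `J_n(t)` of the first kind of integer order `n`, by its integral
representation `J_n(t) = (i ^ n / 2π) ∫_0^{2π} exp (i n k - i t cos k) dk`. -/
noncomputable def besselJInt (n : ℤ) (t : ℝ) : ℂ :=
  Complex.I ^ n / (2 * Real.pi) *
    ∫ k in (0 : ℝ)..(2 * Real.pi),
      Complex.exp (Complex.I * n * k - Complex.I * t * Real.cos k)

/-- The Bessel function `J_ν(z)` of the first kind of arbitrary order `ν`, by its power series
`J_ν(z) = (z/2)^ν ∑_m (-1)^m / (m! Γ(m + ν + 1)) (z/2)^(2m)`, where `(z/2)^ν` is the principal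
branch. Mathlib's `Complex.Gamma` vanishes at its poles, so that `1 / Γ` is `0` there, as usual. -/
noncomputable def besselJ (ν z : ℂ) : ℂ :=
  (z / 2) ^ ν *
    ∑' m : ℕ, (-1) ^ m / (m.factorial * Complex.Gamma (m + ν + 1)) * (z / 2) ^ (2 * m)

open Set Filter Topology

/-! Both claims reduce to x(ρ + |x − ν|) f(x)⁴ ≤ 1 for f = J_ν, x > 0, ρ = ν^(1/3) and ν = 0 or ν ≥
1 (`mul_besselReal_pow_four_le`). Every |n| is such a ν, and only moduli of the order (for integers)
and of the argument matter.

In the oscillatory region x > ν, Sonin's function for the Liouville–Green transform (x² − ν²)^(1/4)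
f is nondecreasing. Hence √(x² − ν²) f² is controlled by the amplitude at infinity
(`sqrt_mul_sq_le`). Poisson's integral, moved into the upper half-plane, bounds the limsup of x f²
by 2/π (`eventually_sqrt_mul_abs_besselReal_le`). As (2/π)² < 1/2, this gives (x² − ν²) f⁴ ≤ 1/2.

That bound is empty at the turning point x = ν. For ν ≥ 1, the quotient φ = x f'/f solves the
Riccati equation x φ' = ν² − x² − φ², and explicit subsolutions show that f increases up to b = √(ν²
+ ν^(4/3)), just past the turning point (`snd_lower_bounds`, `fst_nonneg`). So the bound at b, ρ⁴
f(b)⁴ ≤ 1/2, holds on all of [0, b]. Farther left the growth rate x f'/f ≥ ρ² pays for the factor |x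
− ν|. -/

/-! ### Comparison principle -/

/-- A function that starts nonnegative and does not decrease where it is negative stays
nonnegative. -/
theorem nonneg_of_deriv_nonneg_of_neg {D D' : ℝ → ℝ} {a b : ℝ} (hc : ContinuousOn D (Icc a b))
    (hd : ∀ x ∈ Ioo a b, HasDerivAt D (D' x) x) (h : ∀ x ∈ Ioo a b, D x < 0 → 0 ≤ D' x)
    (ha : 0 ≤ D a) : ∀ x ∈ Icc a b, 0 ≤ D x := by
  intro b' hb'
  by_contra! hneg
  have hc' : ContinuousOn D (Icc a b') := hc.mono (Icc_subset_Icc_right hb'.2)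
  set S := Icc a b' ∩ D ⁻¹' Ici 0 with hS
  have hScl : IsClosed S := hc'.preimage_isClosed_of_isClosed isClosed_Icc isClosed_Ici
  have hSc : IsCompact S := isCompact_Icc.of_isClosed_subset hScl inter_subset_left
  have hSne : S.Nonempty := ⟨a, ⟨le_rfl, hb'.1⟩, ha⟩
  -- `c` is the last point before `b'` where `D` is nonnegative; beyond it `D` is negative, hence
  -- nondecreasing, and cannot have dropped below zero.
  obtain ⟨c, ⟨hcI, hc0⟩, hcmax⟩ := hSc.exists_isGreatest hSne
  have hc0 : 0 ≤ D c := hc0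
  have hcb : c < b' := lt_of_le_of_ne hcI.2 (by rintro rfl; linarith)
  have hsub : ∀ x ∈ Ioo c b', x ∈ Ioo a b := fun x hx =>
    ⟨hcI.1.trans_lt hx.1, hx.2.trans_le hb'.2⟩
  have hmono : MonotoneOn D (Icc c b') := by
    apply monotoneOn_of_deriv_nonneg (convex_Icc _ _) (hc'.mono (Icc_subset_Icc_left hcI.1))
    · rw [interior_Icc]
      exact fun x hx => (hd x (hsub x hx)).differentiableAt.differentiableWithinAt
    · rw [interior_Icc]
      intro x hx
      rw [(hd x (hsub x hx)).deriv]
      apply h x (hsub x hx)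
      by_contra! hx0
      have := hcmax ⟨⟨hcI.1.trans hx.1.le, hx.2.le⟩, hx0⟩
      exact absurd hx.1 (not_lt.mpr this)
  have := hmono (left_mem_Icc.mpr hcb.le) (right_mem_Icc.mpr hcb.le) hcb.le
  linarith

/-! ### Riccati comparison: growth up to just past the turning point -/

/-- `f` and `p` satisfy, on the positive half-line, the first-order system `x f' = p`,
`x p' = (ν² - x²) f` equivalent to Bessel's equation. -/
structure IsBesselPair (ν : ℝ) (f p : ℝ → ℝ) : Prop where
  deriv_fst : ∀ x, 0 < x → HasDerivAt f (p x / x) x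
  deriv_snd : ∀ x, 0 < x → HasDerivAt p ((ν ^ 2 - x ^ 2) / x * f x) x

namespace IsBesselPair

variable {ν : ℝ} {f p : ℝ → ℝ}

/-- Subsolutions `φ` of the Riccati equation bound the logarithmic derivative from below. -/
theorem mul_le_snd (h : IsBesselPair ν f p) {φ φ' : ℝ → ℝ} {a b : ℝ} (ha : 0 ≤ a)
    (hfc : ContinuousOn f (Icc a b)) (hpc : ContinuousOn p (Icc a b))
    (hφ : ∀ x, HasDerivAt φ (φ' x) x) (hφ0 : ∀ x ∈ Icc a b, 0 ≤ φ x)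
    (hf : ∀ x ∈ Icc a b, 0 ≤ f x)
    (hsub : ∀ x ∈ Ioo a b, x * φ' x ≤ ν ^ 2 - x ^ 2 - φ x ^ 2)
    (hstart : φ a * f a ≤ p a) : ∀ x ∈ Icc a b, φ x * f x ≤ p x := by
  intro x hx
  have key := nonneg_of_deriv_nonneg_of_neg (D := fun x => p x - φ x * f x)
    (D' := fun x => (ν ^ 2 - x ^ 2) / x * f x - (φ' x * f x + φ x * (p x / x))) (a := a) (b := b)
    (hpc.sub (ContinuousOn.mul (fun x _ => (hφ x).continuousAt.continuousWithinAt) hfc))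
    (fun x hx => (h.deriv_snd x (ha.trans_lt hx.1)).sub
      ((hφ x).mul (h.deriv_fst x (ha.trans_lt hx.1))))
    (fun x hx hneg => ?_) (by simpa using hstart) x hx
  · simpa using key
  · have hx0 : 0 < x := ha.trans_lt hx.1
    have hxI := Ioo_subset_Icc_self hx
    -- With D = p − φ f, this derivative is the Riccati deficit times f / x, plus −φ D / x; both are
    -- nonnegative where D < 0.
    have e : (ν ^ 2 - x ^ 2) / x * f x - (φ' x * f x + φ x * (p x / x)) =
        ((ν ^ 2 - x ^ 2 - φ x ^ 2 - x * φ' x) * f x + φ x * -(p x - φ x * f x)) / x := by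
      field_simp
      ring
    rw [e]
    have h1 := mul_nonneg (sub_nonneg.mpr (hsub x hx)) (hf x hxI)
    have h2 := mul_nonneg (hφ0 x hxI) (neg_nonneg.mpr hneg.le)
    positivity

theorem monotoneOn_fst (h : IsBesselPair ν f p) {a b : ℝ} (ha : 0 ≤ a)
    (hfc : ContinuousOn f (Icc a b)) (hp : ∀ x ∈ Icc a b, 0 ≤ p x) : MonotoneOn f (Icc a b) := by
  apply monotoneOn_of_deriv_nonneg (convex_Icc _ _) hfc
  · rw [interior_Icc]
    exact fun x hx =>
      (h.deriv_fst x (ha.trans_lt hx.1)).differentiableAt.differentiableWithinAt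
  · rw [interior_Icc]
    intro x hx
    have hx0 := ha.trans_lt hx.1
    rw [(h.deriv_fst x hx0).deriv]
    exact div_nonneg (hp x (Ioo_subset_Icc_self hx)) hx0.le

section Increasing

variable {ρ : ℝ}

/-- Two subsolutions are glued at x² = ρ⁶ − ρ⁴: the constant ρ², then (ρ⁶ + ρ⁴ − x²) / (2ρ²), which
falls from ρ² to 0 at x² = ρ⁶ + ρ⁴. -/
theorem snd_lower_bounds (h : IsBesselPair (ρ ^ 3) f p) (hρ : 1 ≤ ρ) (hfc : ContinuousOn f (Ici 0))
    (hpc : ContinuousOn p (Ici 0)) (hf0 : f 0 = 0) (hp0 : p 0 = 0) {b : ℝ}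
    (hb : b ^ 2 ≤ ρ ^ 6 + ρ ^ 4) (hf : ∀ x ∈ Icc 0 b, 0 ≤ f x) :
    (∀ x ∈ Icc 0 b, x ^ 2 ≤ ρ ^ 6 - ρ ^ 4 → ρ ^ 2 * f x ≤ p x) ∧ ∀ x ∈ Icc 0 b, 0 ≤ p x := by
  have first : ∀ x ∈ Icc 0 b, x ^ 2 ≤ ρ ^ 6 - ρ ^ 4 → ρ ^ 2 * f x ≤ p x := by
    intro x hx hx2
    refine h.mul_le_snd (φ := fun _ => ρ ^ 2) (φ' := fun _ => 0) le_rfl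
      (hfc.mono Icc_subset_Ici_self) (hpc.mono Icc_subset_Ici_self)
      (fun x => hasDerivAt_const x _) (fun _ _ => by positivity)
      (fun y hy => hf y ⟨hy.1, hy.2.trans hx.2⟩) (fun y hy => ?_) (by simp [hf0, hp0]) x
      ⟨hx.1, le_rfl⟩
    have : y ^ 2 ≤ x ^ 2 := pow_le_pow_left₀ hy.1.le hy.2.le 2
    nlinarith
  refine ⟨first, fun x hx => ?_⟩
  rcases le_total (x ^ 2) (ρ ^ 6 - ρ ^ 4) with hx2 | hx2
  · exact (mul_nonneg (by positivity) (hf x hx)).trans (first x hx hx2)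
  have hρ4 : ρ ^ 4 ≤ ρ ^ 6 := pow_le_pow_right₀ hρ (by norm_num)
  set a := √(ρ ^ 6 - ρ ^ 4) with ha
  have ha0 : 0 ≤ a := Real.sqrt_nonneg _
  have ha2 : a ^ 2 = ρ ^ 6 - ρ ^ 4 := Real.sq_sqrt (by linarith)
  have hax : a ≤ x := (Real.sqrt_le_left hx.1).mpr hx2
  have hρ2 : (0 : ℝ) < ρ ^ 2 := by positivity
  have hx2b : x ^ 2 ≤ ρ ^ 6 + ρ ^ 4 := (pow_le_pow_left₀ hx.1 hx.2 2).trans hb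
  have hφ0 : ∀ y ∈ Icc a x, 0 ≤ (ρ ^ 6 + ρ ^ 4 - y ^ 2) / (2 * ρ ^ 2) := fun y hy => by
    have : y ^ 2 ≤ x ^ 2 := pow_le_pow_left₀ (ha0.trans hy.1) hy.2 2
    exact div_nonneg (by linarith) (by positivity)
  have hf' : ∀ y ∈ Icc a x, 0 ≤ f y := fun y hy => hf y ⟨ha0.trans hy.1, hy.2.trans hx.2⟩
  refine (mul_nonneg (hφ0 x ⟨hax, le_rfl⟩) (hf x hx)).trans
    (h.mul_le_snd (φ := fun y => (ρ ^ 6 + ρ ^ 4 - y ^ 2) / (2 * ρ ^ 2)) (φ' := fun y => -y / ρ ^ 2)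
      ha0 (hfc.mono fun y hy => ha0.trans hy.1) (hpc.mono fun y hy => ha0.trans hy.1)
      (fun y => ?_) hφ0 hf' (fun y hy => ?_) ?_ x ⟨hax, le_rfl⟩)
  · have := ((hasDerivAt_pow 2 y).const_sub (ρ ^ 6 + ρ ^ 4)).div_const (2 * ρ ^ 2)
    refine this.congr_deriv ?_
    norm_num
    field_simp
  · have hya : a ^ 2 ≤ y ^ 2 := pow_le_pow_left₀ ha0 hy.1.le 2
    have hyx : y ^ 2 ≤ x ^ 2 := pow_le_pow_left₀ (ha0.trans hy.1.le) hy.2.le 2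
    -- Scaled variable of the transition region, where t runs over [−1, 1]. The subsolution
    -- inequality becomes `h4` below.
    obtain ⟨t, ht⟩ : ∃ t, y ^ 2 = ρ ^ 6 + ρ ^ 4 * t :=
      ⟨(y ^ 2 - ρ ^ 6) / ρ ^ 4, by field_simp; ring⟩
    have hρ4' : 0 < ρ ^ 4 := by positivity
    have ht1 : -1 ≤ t := by nlinarith
    have ht2 : t ≤ 1 := by nlinarith
    have hρ21 : 1 ≤ ρ ^ 2 := one_le_pow₀ hρ
    have e1 : y * (-y / ρ ^ 2) = -(ρ ^ 4 + ρ ^ 2 * t) := by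
      field_simp
      linear_combination -ht
    have e2 : (ρ ^ 6 + ρ ^ 4 - y ^ 2) / (2 * ρ ^ 2) = ρ ^ 2 * (1 - t) / 2 := by
      field_simp
      linear_combination -ht
    rw [e1, e2, ht]
    have h4 : (1 + t) ^ 2 * ρ ^ 2 ≤ 4 * (ρ ^ 2 + t) := by
      rcases le_total 0 t with h0 | h0
      · nlinarith
      · nlinarith [mul_nonneg (neg_nonneg.mpr h0) (sub_nonneg.mpr hρ21)]
    nlinarith
  · have e2 : (ρ ^ 6 + ρ ^ 4 - a ^ 2) / (2 * ρ ^ 2) = ρ ^ 2 := by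
      rw [ha2]
      field_simp
      ring
    simp only [e2]
    exact first a ⟨ha0, hax.trans hx.2⟩ ha2.le

/-- A solution that starts off positive stays positive up to `√(ν² + ν^(4/3))`. -/
theorem fst_nonneg (h : IsBesselPair (ρ ^ 3) f p) (hρ : 1 ≤ ρ) (hfc : ContinuousOn f (Ici 0))
    (hpc : ContinuousOn p (Ici 0)) (hf0 : f 0 = 0) (hp0 : p 0 = 0)
    (hpos : ∀ᶠ x in 𝓝[>] 0, 0 < f x) {b : ℝ} (hb : b ^ 2 ≤ ρ ^ 6 + ρ ^ 4) :
    ∀ x ∈ Icc 0 b, 0 ≤ f x := by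
  intro z hz
  by_contra! hneg
  obtain ⟨ε, hε0, hε⟩ := mem_nhdsGT_iff_exists_Ioo_subset.mp hpos
  have hε0 : 0 < ε := hε0
  have hεz : ε ≤ z := by
    by_contra! hlt
    rcases hz.1.eq_or_lt with h0 | h0
    · rw [← h0, hf0] at hneg; exact lt_irrefl _ hneg
    · exact absurd (hε ⟨h0, hlt⟩ : 0 < f z) (not_lt.mpr hneg.le)
  have hmem : ε / 2 ∈ Icc 0 z := ⟨by positivity, by linarith⟩
  have hpε : 0 < f (ε / 2) := hε ⟨by positivity, by linarith⟩
  set S := Icc (ε / 2) z ∩ f ⁻¹' Iic 0 with hS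
  have hc' : ContinuousOn f (Icc (ε / 2) z) := hfc.mono fun y hy => hmem.1.trans hy.1
  have hScl : IsClosed S := hc'.preimage_isClosed_of_isClosed isClosed_Icc isClosed_Iic
  have hSc : IsCompact S := isCompact_Icc.of_isClosed_subset hScl inter_subset_left
  have hSne : S.Nonempty := ⟨z, ⟨hmem.2, le_rfl⟩, hneg.le⟩
  -- At the first such point `c`, f ≥ 0 on all of [0, c], so f is increasing there and f c ≥ f (ε /
  -- 2) > 0, a contradiction.
  obtain ⟨c, ⟨hcI, hc0⟩, hcmin⟩ := hSc.exists_isLeast hSne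
  have hc0 : f c ≤ 0 := hc0
  have hclt : ∀ x ∈ Ico 0 c, 0 ≤ f x := by
    intro x hx
    rcases hx.1.eq_or_lt with h0 | h0
    · rw [← h0, hf0]
    rcases lt_or_ge x ε with h1 | h1
    · exact (hε ⟨h0, h1⟩ : 0 < f x).le
    · by_contra! h2
      have := hcmin ⟨⟨by linarith, hx.2.le.trans hcI.2⟩, h2.le⟩
      exact absurd hx.2 (not_lt.mpr this)
  have hc00 : 0 < c := by linarith [hcI.1]
  have hfc0 : 0 ≤ f c := by
    have ht : Tendsto f (𝓝[<] c) (𝓝 (f c)) :=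
      ((h.deriv_fst c hc00).continuousAt.tendsto).mono_left nhdsWithin_le_nhds
    refine ge_of_tendsto ht ?_
    filter_upwards [Ioo_mem_nhdsLT hc00] with x hx using hclt x ⟨hx.1.le, hx.2⟩
  have hall : ∀ x ∈ Icc 0 c, 0 ≤ f x := by
    intro x hx
    rcases hx.2.eq_or_lt with h0 | h0
    · rwa [h0]
    · exact hclt x ⟨hx.1, h0⟩
  have hcb : c ^ 2 ≤ ρ ^ 6 + ρ ^ 4 :=
    (pow_le_pow_left₀ hc00.le (hcI.2.trans hz.2) 2).trans hb
  have hp := (h.snd_lower_bounds hρ hfc hpc hf0 hp0 hcb hall).2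
  have := h.monotoneOn_fst le_rfl (hfc.mono Icc_subset_Ici_self) hp
    ⟨hmem.1, hcI.1⟩ ⟨hc00.le, le_rfl⟩ hcI.1
  linarith

end Increasing

end IsBesselPair

/-! ### Sonin's function and Nicholson's bound beyond the turning point -/

namespace IsBesselPair

variable {ν : ℝ} {f p : ℝ → ℝ}

/-- Sonin's function for the Liouville–Green transform of Bessel's equation. -/
noncomputable def sonin (ν : ℝ) (f p : ℝ → ℝ) (x : ℝ) : ℝ :=
  √(x ^ 2 - ν ^ 2) * (f x ^ 2 + ((x ^ 2 - ν ^ 2) * p x + x ^ 2 * f x / 2) ^ 2 /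
    ((x ^ 2 - ν ^ 2) ^ 3 + x ^ 4 / 4 + ν ^ 2 * x ^ 2))

/-- Put q = x² − ν², u = q^(1/4) f and dξ = (√q / x) dx. Bessel's equation becomes u'' + Q u = 0 in
ξ, with Q = 1 + (x⁴/4 + ν²x²)/q³, and `sonin` is u² + u'²/Q. Its derivative is −Q' u'²/Q²,
nonnegative because Q decreases. -/
theorem hasDerivAt_sonin (h : IsBesselPair ν f p) (hν : 0 ≤ ν) {x : ℝ} (hx : ν < x) :
    HasDerivAt (sonin ν f p)
      (√(x ^ 2 - ν ^ 2) * ((x ^ 2 - ν ^ 2) * p x + x ^ 2 * f x / 2) ^ 2 *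
        (x ^ 5 / 2 + 5 * ν ^ 2 * x ^ 3 + 2 * ν ^ 4 * x) /
        (((x ^ 2 - ν ^ 2) ^ 3 + x ^ 4 / 4 + ν ^ 2 * x ^ 2) ^ 2 * (x ^ 2 - ν ^ 2))) x := by
  have hx0 : 0 < x := hν.trans_lt hx
  have hq : 0 < x ^ 2 - ν ^ 2 := by nlinarith
  have hT : 0 < (x ^ 2 - ν ^ 2) ^ 3 + x ^ 4 / 4 + ν ^ 2 * x ^ 2 := by positivity
  have dq : HasDerivAt (fun x : ℝ => x ^ 2 - ν ^ 2) (2 * x) x := by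
    simpa using (hasDerivAt_pow 2 x).sub_const (ν ^ 2)
  have dx2 : HasDerivAt (fun x : ℝ => x ^ 2) (2 * x) x := by simpa using hasDerivAt_pow 2 x
  have dx4 : HasDerivAt (fun x : ℝ => x ^ 4) (4 * x ^ 3) x := by simpa using hasDerivAt_pow 4 x
  have df := h.deriv_fst x hx0
  have dp := h.deriv_snd x hx0
  have dP := (dq.mul dp).add ((dx2.mul df).div_const 2)
  have dT := ((dq.pow 3).add (dx4.div_const 4)).add (dx2.const_mul (ν ^ 2))
  have := (dq.sqrt hq.ne').mul ((df.pow 2).add ((dP.pow 2).div dT hT.ne'))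
  refine this.congr_deriv ?_
  simp only [Pi.add_apply, Pi.mul_apply, Pi.pow_apply, Pi.div_apply]
  have hs : √(x ^ 2 - ν ^ 2) ^ 2 = x ^ 2 - ν ^ 2 := Real.sq_sqrt hq.le
  have e1 : 2 * x / (2 * √(x ^ 2 - ν ^ 2)) = √(x ^ 2 - ν ^ 2) * (x / (x ^ 2 - ν ^ 2)) := by
    have := Real.sqrt_pos.mpr hq
    rw [← hs, Real.sqrt_sq this.le]
    field_simp
  rw [e1]
  have hs0 := Real.sqrt_pos.mpr hq
  clear hs e1
  generalize √(x ^ 2 - ν ^ 2) = s at hs0 ⊢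
  -- With q and T as atoms and ν² eliminated through q, the claim becomes a rational identity.
  obtain ⟨q, hqe⟩ : ∃ q, q = x ^ 2 - ν ^ 2 := ⟨_, rfl⟩
  obtain ⟨T, hTe⟩ : ∃ T, T = q ^ 3 + x ^ 4 / 4 + ν ^ 2 * x ^ 2 := ⟨_, rfl⟩
  have hn : ν ^ 2 - x ^ 2 = -q := by rw [hqe]; ring
  rw [hn]
  rw [← hqe] at hT hq ⊢
  rw [← hTe] at hT ⊢
  have hν2 : ν ^ 2 = x ^ 2 - q := by rw [hqe]; ring
  have hν4 : ν ^ 4 = (x ^ 2 - q) ^ 2 := by rw [← hν2]; ring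
  rw [hν2] at hTe
  rw [hν2, hν4]
  norm_num
  field_simp
  rw [hTe]
  ring

theorem monotoneOn_sonin (h : IsBesselPair ν f p) (hν : 0 ≤ ν) :
    MonotoneOn (sonin ν f p) (Ioi ν) := by
  apply monotoneOn_of_deriv_nonneg (convex_Ioi _)
  · exact fun x hx => (h.hasDerivAt_sonin hν hx).continuousAt.continuousWithinAt
  · rw [interior_Ioi]
    exact fun x hx => (h.hasDerivAt_sonin hν hx).differentiableAt.differentiableWithinAt
  · rw [interior_Ioi]
    intro x hx
    have hx0 : 0 < x := hν.trans_lt hx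
    have hx' : ν < x := hx
    have hq : 0 < x ^ 2 - ν ^ 2 := by nlinarith
    rw [(h.hasDerivAt_sonin hν hx).deriv]
    positivity

theorem sqrt_mul_sq_le_sonin (hν : 0 ≤ ν) {x : ℝ} (hx : ν < x) :
    √(x ^ 2 - ν ^ 2) * f x ^ 2 ≤ sonin ν f p x := by
  have hx0 : 0 < x := hν.trans_lt hx
  have hq : 0 < x ^ 2 - ν ^ 2 := by nlinarith
  refine mul_le_mul_of_nonneg_left (le_add_of_nonneg_right ?_) (Real.sqrt_nonneg _)
  positivity

/-- This relates the second term of `sonin` to an ordinary x-derivative, to which the mean value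
theorem applies. -/
theorem hasDerivAt_liouvilleGreen (h : IsBesselPair ν f p) (hν : 0 ≤ ν) {x : ℝ} (hx : ν < x) :
    HasDerivAt (fun x => √(√(x ^ 2 - ν ^ 2)) * f x)
      (((x ^ 2 - ν ^ 2) * p x + x ^ 2 * f x / 2) /
        (x * √(x ^ 2 - ν ^ 2) * √(√(x ^ 2 - ν ^ 2)))) x := by
  have hx0 : 0 < x := hν.trans_lt hx
  have hq : 0 < x ^ 2 - ν ^ 2 := by nlinarith
  have hs := Real.sqrt_pos.mpr hq
  have hr := Real.sqrt_pos.mpr hs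
  have dq : HasDerivAt (fun x : ℝ => x ^ 2 - ν ^ 2) (2 * x) x := by
    simpa using (hasDerivAt_pow 2 x).sub_const (ν ^ 2)
  refine (((dq.sqrt hq.ne').sqrt hs.ne').mul (h.deriv_fst x hx0)).congr_deriv ?_
  have e1 : x ^ 2 - ν ^ 2 = √(√(x ^ 2 - ν ^ 2)) ^ 4 := by
    rw [show 4 = 2 * 2 by rfl, pow_mul, Real.sq_sqrt hs.le, Real.sq_sqrt hq.le]
  have e2 : √(x ^ 2 - ν ^ 2) = √(√(x ^ 2 - ν ^ 2)) ^ 2 := (Real.sq_sqrt hs.le).symm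
  generalize √(√(x ^ 2 - ν ^ 2)) = r at *
  rw [e2, e1]
  field_simp
  ring

/-- The denominator is at least q³, q = x² − ν², and passing from the Liouville variable to x costs
x²/q ≤ 2. -/
theorem sonin_le_of_liouvilleGreen (hν : 0 ≤ ν) {x : ℝ} (hx : ν < x)
    (hx2 : 2 * ν ^ 2 ≤ x ^ 2) :
    sonin ν f p x ≤ √(x ^ 2 - ν ^ 2) * f x ^ 2 +
      2 * (((x ^ 2 - ν ^ 2) * p x + x ^ 2 * f x / 2) /
        (x * √(x ^ 2 - ν ^ 2) * √(√(x ^ 2 - ν ^ 2)))) ^ 2 := by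
  have hx0 : 0 < x := hν.trans_lt hx
  have hq : 0 < x ^ 2 - ν ^ 2 := by nlinarith
  have hs := Real.sqrt_pos.mpr hq
  have hr := Real.sqrt_pos.mpr hs
  have e1 : x ^ 2 - ν ^ 2 = √(x ^ 2 - ν ^ 2) ^ 2 := (Real.sq_sqrt hq.le).symm
  rw [sonin, mul_add, div_pow, mul_pow, mul_pow, Real.sq_sqrt hs.le]
  set P := ((x ^ 2 - ν ^ 2) * p x + x ^ 2 * f x / 2) ^ 2
  have hP : 0 ≤ P := by positivity
  refine add_le_add_right ?_ _
  calc √(x ^ 2 - ν ^ 2) * (P / ((x ^ 2 - ν ^ 2) ^ 3 + x ^ 4 / 4 + ν ^ 2 * x ^ 2))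
      ≤ √(x ^ 2 - ν ^ 2) * (P / (x ^ 2 - ν ^ 2) ^ 3) := by
        gcongr
        have : 0 ≤ x ^ 4 / 4 + ν ^ 2 * x ^ 2 := by positivity
        linarith
    _ = P / (√(x ^ 2 - ν ^ 2) ^ 2 * √(x ^ 2 - ν ^ 2) * (x ^ 2 - ν ^ 2)) := by
        rw [← e1]
        generalize √(x ^ 2 - ν ^ 2) = s at *
        rw [e1]; field_simp
    _ ≤ P / (√(x ^ 2 - ν ^ 2) ^ 2 * √(x ^ 2 - ν ^ 2) * (x ^ 2 / 2)) := by
        gcongr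
        linarith
    _ = 2 * (P / (x ^ 2 * √(x ^ 2 - ν ^ 2) ^ 2 * √(x ^ 2 - ν ^ 2))) := by
        field_simp

/-- Nicholson's bound, from an upper bound of the amplitude at infinity. -/
theorem sqrt_mul_sq_le (h : IsBesselPair ν f p) (hν : 0 ≤ ν) {K' K : ℝ} (hK : K' < K)
    (hlim : ∀ᶠ x in atTop, x * f x ^ 2 ≤ K') {x : ℝ} (hx : ν < x) :
    √(x ^ 2 - ν ^ 2) * f x ^ 2 ≤ K := by
  obtain ⟨a, ha⟩ := eventually_atTop.mp
    (hlim.and (eventually_ge_atTop (max x (2 * ν))))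
  have hK0 : 0 ≤ K' := by
    have := ha a le_rfl
    have hxa : x ≤ a := (le_max_left _ _).trans this.2
    have : 0 ≤ a := (hν.trans hx.le).trans hxa
    exact (by positivity : 0 ≤ a * f a ^ 2).trans (ha a le_rfl).1
  have hfar : ∀ y, a ≤ y → ν < y ∧ x ≤ y ∧ 2 * ν ^ 2 ≤ y ^ 2 ∧
      √(y ^ 2 - ν ^ 2) * f y ^ 2 ≤ K' := by
    intro y hy
    obtain ⟨h1, h2⟩ := ha y hy
    have h3 : x ≤ y := (le_max_left _ _).trans h2
    have h4 : 2 * ν ≤ y := (le_max_right _ _).trans h2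
    have hy0 : 0 ≤ y := (hν.trans hx.le).trans h3
    refine ⟨hx.trans_le h3, h3, by nlinarith, le_trans ?_ h1⟩
    gcongr
    rw [Real.sqrt_le_left hy0]
    nlinarith [sq_nonneg ν]
  set g := fun x => √(√(x ^ 2 - ν ^ 2)) * f x with hg
  have hgsq : ∀ y, g y ^ 2 = √(y ^ 2 - ν ^ 2) * f y ^ 2 := fun y => by
    rw [hg]; simp only; rw [mul_pow, Real.sq_sqrt (Real.sqrt_nonneg _)]
  set η := (K - K') / 2 with hη
  have hη0 : 0 < η := by rw [hη]; linarith
  -- No asymptotics of f' are needed: g² ≤ K' far out, so over an interval of length N the squared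
  -- mean slope is at most 4K'/N² ≤ η, and it is attained by g' at some point c.
  obtain ⟨N, hN⟩ : ∃ N : ℝ, 0 < N ∧ 4 * K' ≤ η * N ^ 2 :=
    ⟨1 + 4 * K' / η, by positivity, by
      have : η * (1 + 4 * K' / η) = η + 4 * K' := by field_simp
      rw [pow_two, ← mul_assoc, this]
      have : 0 ≤ 4 * K' / η := by positivity
      nlinarith⟩
  obtain ⟨c, hc, hslope⟩ := exists_hasDerivAt_eq_slope g _ (show a < a + N by linarith)
    (fun y hy => (h.hasDerivAt_liouvilleGreen hν (hfar y hy.1).1).continuousAt.continuousWithinAt)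
    (fun y hy => h.hasDerivAt_liouvilleGreen hν (hfar y hy.1.le).1)
  obtain ⟨c1, c2, c3, c4⟩ := hfar c hc.1.le
  have hsmall : ((g (a + N) - g a) / (a + N - a)) ^ 2 ≤ η := by
    have h1 := (hgsq a).trans_le (hfar a le_rfl).2.2.2
    have h2 := (hgsq (a + N)).trans_le (hfar (a + N) (by linarith)).2.2.2
    rw [add_sub_cancel_left, div_pow, div_le_iff₀ (by have := hN.1; positivity)]
    nlinarith [sq_nonneg (g (a + N) + g a)]
  calc √(x ^ 2 - ν ^ 2) * f x ^ 2 ≤ sonin ν f p x := sqrt_mul_sq_le_sonin hν hx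
    _ ≤ sonin ν f p c := h.monotoneOn_sonin hν hx c1 c2
    _ ≤ _ := sonin_le_of_liouvilleGreen hν c1 c3
    _ ≤ K' + 2 * η := by rw [hslope]; gcongr
    _ = K := by rw [hη]; ring

end IsBesselPair

/-! ### The quartic estimate in the four ranges of x -/

namespace IsBesselPair

variable {ν ρ : ℝ} {f p : ℝ → ℝ}

theorem sub_mul_pow_four_le (h : IsBesselPair ν f p) (hν : 0 ≤ ν)
    (hlim : ∀ᶠ x in atTop, x * f x ^ 2 ≤ 13 / 20) {x : ℝ} (hx : ν < x) :
    (x ^ 2 - ν ^ 2) * f x ^ 4 ≤ 1 / 2 := by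
  have hq : 0 ≤ x ^ 2 - ν ^ 2 := by nlinarith
  -- The constants satisfy 2/π < 13/20 < 7/10 and (7/10)² < 1/2.
  have h1 := h.sqrt_mul_sq_le hν (show (13 / 20 : ℝ) < 7 / 10 by norm_num) hlim hx
  have h2 : (√(x ^ 2 - ν ^ 2) * f x ^ 2) ^ 2 ≤ (7 / 10) ^ 2 := by gcongr
  rw [mul_pow, Real.sq_sqrt hq] at h2
  nlinarith

theorem mul_pow_four_le_one (h : IsBesselPair (ρ ^ 3) f p) (hρ : 1 ≤ ρ)
    (hfc : ContinuousOn f (Ici 0)) (hpc : ContinuousOn p (Ici 0)) (hf0 : f 0 = 0) (hp0 : p 0 = 0)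
    (hpos : ∀ᶠ x in 𝓝[>] 0, 0 < f x) (hlim : ∀ᶠ x in atTop, x * f x ^ 2 ≤ 13 / 20)
    {x : ℝ} (hx : 0 < x) : x * (ρ + |x - ρ ^ 3|) * f x ^ 4 ≤ 1 := by
  have hρ0 : 0 < ρ := by linarith
  have hρ3 : ρ ≤ ρ ^ 3 := by nlinarith [mul_pos hρ0 hρ0, sq_nonneg (ρ - 1)]
  have hν : 0 ≤ ρ ^ 3 := by positivity
  set b := √(ρ ^ 6 + ρ ^ 4) with hb
  have hb0 : 0 ≤ b := Real.sqrt_nonneg _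
  have hb2 : b ^ 2 = ρ ^ 6 + ρ ^ 4 := Real.sq_sqrt (by positivity)
  have hρb : ρ ^ 3 < b := by
    refine lt_of_pow_lt_pow_left₀ 2 hb0 ?_
    rw [hb2]
    have : 0 < ρ ^ 4 := by positivity
    nlinarith
  have hf := h.fst_nonneg hρ hfc hpc hf0 hp0 hpos hb2.le
  obtain ⟨hp1, hp2⟩ := h.snd_lower_bounds hρ hfc hpc hf0 hp0 hb2.le hf
  have hmono := h.monotoneOn_fst le_rfl (hfc.mono Icc_subset_Ici_self) hp2
  -- Equivalent to y² + (ρ³ − ρ) y ≥ 2ρ⁶; the lower bounds ρ⁶ + ρ⁴ and ρ⁶ − ρ⁴ of the two terms add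
  -- up to exactly this.
  have hright : ∀ y, b ≤ y → y * (ρ + (y - ρ ^ 3)) ≤ 2 * (y ^ 2 - (ρ ^ 3) ^ 2) := by
    intro y hy
    have h1 : b ^ 2 ≤ y ^ 2 := pow_le_pow_left₀ hb0 hy 2
    have h2 : (ρ ^ 3 - ρ) * ρ ^ 3 ≤ (ρ ^ 3 - ρ) * y :=
      mul_le_mul_of_nonneg_left (hρb.le.trans hy) (by linarith)
    nlinarith
  rcases le_total b x with hbx | hbx
  · have h1 := h.sub_mul_pow_four_le hν hlim (hρb.trans_le hbx)
    rw [abs_of_nonneg (by linarith)]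
    have h2 := mul_le_mul_of_nonneg_right (hright x hbx) (by positivity : 0 ≤ f x ^ 4)
    linarith
  have hfb := h.sub_mul_pow_four_le hν hlim hρb
  have hfb' : ρ ^ 4 * f b ^ 4 ≤ 1 / 2 := by
    rw [hb2] at hfb
    refine le_trans (le_of_eq ?_) hfb
    ring
  have hle : ∀ y ∈ Icc 0 b, ρ ^ 4 * f y ^ 4 ≤ 1 / 2 := fun y hy => by
    have h0 := hf y hy
    have h1 := hmono hy ⟨hb0, le_rfl⟩ hy.2
    refine le_trans ?_ hfb'
    gcongr
  have hfx := hle x ⟨hx.le, hbx⟩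
  have hfx4 : 0 ≤ f x ^ 4 := by positivity
  have hmid : x * (ρ + |x - ρ ^ 3|) ≤ 2 * ρ ^ 4 → x * (ρ + |x - ρ ^ 3|) * f x ^ 4 ≤ 1 :=
    fun hle' => by
      have := mul_le_mul_of_nonneg_right hle' hfx4
      linarith
  rcases le_total (ρ ^ 3) x with hνx | hνx
  · apply hmid
    rw [abs_of_nonneg (by linarith)]
    calc x * (ρ + (x - ρ ^ 3)) ≤ b * (ρ + (b - ρ ^ 3)) := by gcongr
      _ ≤ _ := hright b le_rfl
      _ = 2 * ρ ^ 4 := by rw [hb2]; ring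
  rw [abs_of_nonpos (by linarith)] at hmid ⊢
  rcases le_total (ρ ^ 3 - ρ) x with hνx' | hνx'
  · apply hmid
    calc x * (ρ + -(x - ρ ^ 3)) ≤ ρ ^ 3 * (2 * ρ) := by
          gcongr
          · linarith
          · linarith
      _ = 2 * ρ ^ 4 := by ring
  set c := ρ ^ 3 - ρ with hc
  have hcb : c ≤ b := by linarith
  have hc0 : 0 ≤ c := hx.le.trans hνx'
  have hc2 : c ^ 2 ≤ ρ ^ 6 - ρ ^ 4 := by
    have : ρ ^ 2 ≤ ρ ^ 4 := pow_le_pow_right₀ hρ (by norm_num)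
    rw [hc]
    nlinarith
  -- The logarithmic derivative of f⁴ is at least 4ρ²/ρ³ = 4/ρ where f > 0, while the linear factor,
  -- at least 2ρ here, loses at most 1/(2ρ).
  have hm : MonotoneOn (fun y => (ρ + ρ ^ 3 - y) * f y ^ 4) (Icc 0 c) := by
    have hd : ∀ y ∈ Ioo 0 c, HasDerivAt (fun y => (ρ + ρ ^ 3 - y) * f y ^ 4)
        (-1 * f y ^ 4 + (ρ + ρ ^ 3 - y) * (4 * f y ^ 3 * (p y / y))) y := fun y hy => by
      have := ((hasDerivAt_id y).const_sub (ρ + ρ ^ 3)).mul ((h.deriv_fst y hy.1).pow 4)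
      exact this.congr_deriv (by norm_num)
    apply monotoneOn_of_deriv_nonneg (convex_Icc _ _)
    · exact (continuousOn_const.sub continuousOn_id).mul
        ((hfc.mono Icc_subset_Ici_self).pow 4)
    · rw [interior_Icc]
      exact fun y hy => (hd y hy).differentiableAt.differentiableWithinAt
    · rw [interior_Icc]
      intro y hy
      rw [(hd y hy).deriv]
      have hyb : y ∈ Icc 0 b := ⟨hy.1.le, hy.2.le.trans hcb⟩
      have hy2 : y ^ 2 ≤ c ^ 2 := pow_le_pow_left₀ hy.1.le hy.2.le 2
      have h1 := hp1 y hyb (hy2.trans hc2)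
      have h0 := hf y hyb
      have h2 : ρ ^ 2 * f y / ρ ^ 3 ≤ p y / y := by
        have := hy.2
        exact div_le_div₀ (hp2 y hyb) h1 hy.1 (by linarith)
      have h3 : 2 * ρ ≤ ρ + ρ ^ 3 - y := by linarith [hy.2]
      calc (0 : ℝ) ≤ -1 * f y ^ 4 + (2 * ρ) * (4 * f y ^ 3 * (ρ ^ 2 * f y / ρ ^ 3)) := by
            have : (2 * ρ) * (4 * f y ^ 3 * (ρ ^ 2 * f y / ρ ^ 3)) = 8 * f y ^ 4 := by
              field_simp; ring
            rw [this]
            have : 0 ≤ f y ^ 4 := by positivity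
            linarith
        _ ≤ _ := by
          have : 0 ≤ ρ + ρ ^ 3 - y := by linarith
          gcongr
  have h1 : (ρ + ρ ^ 3 - x) * f x ^ 4 ≤ (ρ + ρ ^ 3 - c) * f c ^ 4 :=
    hm ⟨hx.le, hνx'⟩ ⟨hc0, le_rfl⟩ hνx'
  have h2 := hle c ⟨hc0, hcb⟩
  have h3 : (ρ + ρ ^ 3 - x) * f x ^ 4 * x ≤ (ρ + ρ ^ 3 - c) * f c ^ 4 * ρ ^ 3 := by
    have : 0 ≤ (ρ + ρ ^ 3 - x) * f x ^ 4 := mul_nonneg (by linarith) hfx4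
    exact mul_le_mul h1 hνx hx.le (this.trans h1)
  calc x * (ρ + -(x - ρ ^ 3)) * f x ^ 4 = (ρ + ρ ^ 3 - x) * f x ^ 4 * x := by ring
    _ ≤ _ := h3
    _ = 2 * (ρ ^ 4 * f c ^ 4) := by rw [hc]; ring
    _ ≤ 1 := by linarith

end IsBesselPair

/-! ### The power series -/

/-- `∑ (-1)^m y^m / (m! Γ(m + ν + 1))`. -/
noncomputable def besselSeries (ν y : ℝ) : ℝ :=
  ∑' m : ℕ, (-1) ^ m / (m.factorial * Real.Gamma (m + ν + 1)) * y ^ m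

theorem Gamma_le_Gamma_nat_add {ν : ℝ} (hν : 0 ≤ ν) (m : ℕ) :
    Real.Gamma (ν + 1) ≤ Real.Gamma (m + ν + 1) := by
  induction m with
  | zero => simp
  | succ m ih =>
    have h0 : 0 < Real.Gamma (m + ν + 1) := Real.Gamma_pos_of_pos (by positivity)
    rw [show ((m + 1 : ℕ) : ℝ) + ν + 1 = (m + ν + 1) + 1 by push_cast; ring,
      Real.Gamma_add_one (s := m + ν + 1) (by positivity)]
    have : 0 ≤ (m : ℝ) := m.cast_nonneg
    nlinarith

theorem norm_besselSeries_coeff_le {ν : ℝ} (hν : 0 ≤ ν) (m : ℕ) :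
    ‖(-1) ^ m / (m.factorial * Real.Gamma (m + ν + 1))‖ ≤
      (Real.Gamma (ν + 1))⁻¹ * (1 / m.factorial) := by
  have h0 : 0 < Real.Gamma (ν + 1) := Real.Gamma_pos_of_pos (by positivity)
  have h1 := Gamma_le_Gamma_nat_add hν m
  have h2 := h0.trans_le h1
  rw [norm_div, norm_mul, norm_pow, norm_neg, norm_one, one_pow, Real.norm_of_nonneg h2.le,
    Real.norm_natCast, ← one_div, div_mul_div_comm, mul_one, mul_comm (Real.Gamma (ν + 1))]
  gcongr

theorem summable_besselSeries {ν : ℝ} (hν : 0 ≤ ν) (y : ℝ) :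
    Summable fun m : ℕ => (-1) ^ m / (m.factorial * Real.Gamma (m + ν + 1)) * y ^ m := by
  refine Summable.of_norm_bounded
    ((Real.summable_pow_div_factorial |y|).mul_left (Real.Gamma (ν + 1))⁻¹) fun m => ?_
  rw [norm_mul, norm_pow, Real.norm_eq_abs y]
  calc _ ≤ (Real.Gamma (ν + 1))⁻¹ * (1 / m.factorial) * |y| ^ m := by
        gcongr; exact norm_besselSeries_coeff_le hν m
    _ = _ := by ring

theorem hasDerivAt_besselSeries {ν : ℝ} (hν : 0 ≤ ν) (y : ℝ) :
    HasDerivAt (besselSeries ν) (-besselSeries (ν + 1) y) y := by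
  set c : ℕ → ℝ := fun m => (-1) ^ m / (m.factorial * Real.Gamma (m + ν + 1)) with hc
  -- Any radius beyond |y| gives a ball on which the differentiated series is uniformly dominated.
  set R := |y| + 1 with hR
  set u : ℕ → ℝ := fun m => (Real.Gamma (ν + 1))⁻¹ * (m * R ^ (m - 1) / m.factorial) with hu
  have hshift : ∀ m : ℕ, (((m + 1 : ℕ) : ℝ) * R ^ (m + 1 - 1) / (m + 1).factorial) =
      R ^ m / m.factorial := fun m => by
    rw [Nat.factorial_succ, Nat.add_sub_cancel]
    push_cast
    field_simp
  have hsum : Summable u := by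
    apply Summable.mul_left
    rw [← summable_nat_add_iff 1]
    simp_rw [hshift]
    exact Real.summable_pow_div_factorial R
  have key := hasDerivAt_tsum_of_isPreconnected (𝕜 := ℝ) (g := fun m z => c m * z ^ m)
    (g' := fun m z => c m * (m * z ^ (m - 1))) (t := Metric.ball 0 R) (y₀ := 0) (y := y)
    hsum Metric.isOpen_ball (convex_ball _ _).isPreconnected
    (fun m z _ => (hasDerivAt_pow m z).const_mul _)
    (fun m z hz => ?_) (Metric.mem_ball_self (by positivity)) (summable_besselSeries hν 0)
    (by simp [hR])
  · have e : ∑' m : ℕ, c m * (m * y ^ (m - 1)) = -besselSeries (ν + 1) y := by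
      have hs : Summable fun m : ℕ => c m * (m * y ^ (m - 1)) := by
        rw [← summable_nat_add_iff 1]
        refine ((summable_besselSeries (by linarith : 0 ≤ ν + 1) y).neg).congr fun m => ?_
        rw [hc]
        simp only [Nat.add_sub_cancel, Nat.factorial_succ, pow_succ]
        push_cast
        rw [show (m : ℝ) + 1 + ν + 1 = m + (ν + 1) + 1 by ring]
        field_simp
      rw [hs.tsum_eq_zero_add, besselSeries, ← tsum_neg]
      simp only [Nat.cast_zero, zero_mul, mul_zero, zero_add]
      refine tsum_congr fun m => ?_
      rw [hc]
      simp only [Nat.add_sub_cancel, Nat.factorial_succ, pow_succ]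
      push_cast
      rw [show (m : ℝ) + 1 + ν + 1 = m + (ν + 1) + 1 by ring]
      field_simp
    rw [← e]
    exact key
  · rw [mem_ball_zero_iff] at hz
    rw [norm_mul, norm_mul, norm_pow, Real.norm_natCast]
    calc _ ≤ (Real.Gamma (ν + 1))⁻¹ * (1 / m.factorial) * (m * R ^ (m - 1)) := by
          gcongr
          exact norm_besselSeries_coeff_le hν m
      _ = u m := by rw [hu]; ring

/-- Since Γ(m + ν + 2) = (m + ν + 1) Γ(m + ν + 1), subtracting ν + 1 times the second series leaves
a factor m, which cancels against m! and shifts the index. -/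
theorem besselSeries_recurrence {ν : ℝ} (hν : 0 ≤ ν) (y : ℝ) :
    besselSeries ν y = (ν + 1) * besselSeries (ν + 1) y - y * besselSeries (ν + 2) y := by
  have h1 := summable_besselSeries (by linarith : 0 ≤ ν + 1) y
  have h2 := summable_besselSeries (by linarith : 0 ≤ ν + 2) y
  set d : ℕ → ℝ := fun m =>
    (-1) ^ m / (m.factorial * Real.Gamma (m + ν + 1)) * y ^ m -
      (ν + 1) * ((-1) ^ m / (m.factorial * Real.Gamma (m + (ν + 1) + 1)) * y ^ m) with hd
  have hds : Summable d := (summable_besselSeries hν y).sub (h1.mul_left _)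
  have hG : ∀ m : ℕ, Real.Gamma (m + (ν + 1) + 1) = (m + ν + 1) * Real.Gamma (m + ν + 1) :=
    fun m => by
      rw [← Real.Gamma_add_one (s := m + ν + 1) (by positivity)]
      congr 1
      ring
  have hGpos : ∀ m : ℕ, Real.Gamma (m + ν + 1) ≠ 0 := fun m =>
    (Real.Gamma_pos_of_pos (by positivity)).ne'
  have e : ∑' m, d m = -(y * besselSeries (ν + 2) y) := by
    rw [hds.tsum_eq_zero_add, besselSeries, ← tsum_mul_left, ← tsum_neg]
    have h0 : d 0 = 0 := by
      rw [hd]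
      simp only [hG]
      have := hGpos 0
      have : ν + 1 ≠ 0 := by positivity
      simp at *
      field_simp
      simp
    rw [h0, zero_add]
    refine tsum_congr fun m => ?_
    rw [hd]
    simp only [hG]
    have h3 := hGpos (m + 1)
    have h4 : ((m + 1 : ℕ) : ℝ) + ν + 1 ≠ 0 := by positivity
    rw [show (m : ℝ) + (ν + 2) + 1 = (((m + 1 : ℕ) : ℝ) + ν + 1) + 1 by push_cast; ring,
      Real.Gamma_add_one h4, Nat.factorial_succ]
    generalize Real.Gamma (((m + 1 : ℕ) : ℝ) + ν + 1) = g at *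
    push_cast at *
    field_simp
    ring
  have e2 : ∑' m, d m = besselSeries ν y - (ν + 1) * besselSeries (ν + 1) y := by
    rw [hd, (summable_besselSeries hν y).tsum_sub (h1.mul_left _), tsum_mul_left]
    rfl
  linarith

/-- The Bessel function of real order, as a real function. -/
noncomputable def besselReal (ν x : ℝ) : ℝ := (x / 2) ^ ν * besselSeries ν (x ^ 2 / 4)

theorem besselReal_recurrence {ν x : ℝ} (hν : 0 ≤ ν) (hx : 0 < x) :
    besselReal ν x + besselReal (ν + 2) x = 2 * (ν + 1) / x * besselReal (ν + 1) x := by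
  have h2 : 0 < x / 2 := by positivity
  rw [besselReal, besselReal, besselReal, besselSeries_recurrence hν, Real.rpow_add h2,
    Real.rpow_add h2, Real.rpow_one, Real.rpow_two]
  field_simp
  ring

theorem hasDerivAt_besselReal {ν x : ℝ} (hν : 0 ≤ ν) (hx : 0 < x) :
    HasDerivAt (besselReal ν) ((ν * besselReal ν x - x * besselReal (ν + 1) x) / x) x := by
  have h2 : 0 < x / 2 := by positivity
  have d1 : HasDerivAt (fun x : ℝ => (x / 2) ^ ν) (1 / 2 * ν * (x / 2) ^ (ν - 1)) x :=
    ((hasDerivAt_id x).div_const 2).rpow_const (Or.inl h2.ne')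
  have d2 : HasDerivAt (fun x : ℝ => x ^ 2 / 4) (x / 2) x :=
    ((hasDerivAt_pow 2 x).div_const 4).congr_deriv (by norm_num; ring)
  refine (d1.mul ((hasDerivAt_besselSeries hν (x ^ 2 / 4)).comp x d2)).congr_deriv ?_
  simp only [besselReal, Function.comp]
  rw [Real.rpow_sub h2, Real.rpow_add h2, Real.rpow_one]
  field_simp
  ring

theorem isBesselPair_besselReal {ν : ℝ} (hν : 0 ≤ ν) :
    IsBesselPair ν (besselReal ν) fun x => ν * besselReal ν x - x * besselReal (ν + 1) x where
  deriv_fst x hx := hasDerivAt_besselReal hν hx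
  deriv_snd x hx := by
    have d1 := hasDerivAt_besselReal hν hx
    have d2 := hasDerivAt_besselReal (by linarith : 0 ≤ ν + 1) hx
    refine ((d1.const_mul ν).sub ((hasDerivAt_id x).mul d2)).congr_deriv ?_
    have := besselReal_recurrence hν hx
    rw [show ν + 1 + 1 = ν + 2 by ring, eq_sub_of_add_eq' this]
    simp only [id]
    field_simp
    ring

theorem continuous_besselReal {ν : ℝ} (hν : 0 ≤ ν) : Continuous (besselReal ν) := by
  have h1 : Continuous (besselSeries ν) :=
    continuous_iff_continuousAt.mpr fun y => (hasDerivAt_besselSeries hν y).continuousAt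
  exact ((continuous_id.div_const 2).rpow_const fun _ => Or.inr hν).mul
    (h1.comp ((continuous_pow 2).div_const 4))

theorem besselReal_zero {ν : ℝ} (hν : 0 < ν) : besselReal ν 0 = 0 := by
  simp [besselReal, Real.zero_rpow hν.ne']

theorem eventually_besselReal_pos {ν : ℝ} (hν : 0 ≤ ν) :
    ∀ᶠ x in 𝓝[>] 0, 0 < besselReal ν x := by
  have h0 : 0 < besselSeries ν 0 := by
    have : besselSeries ν 0 = 1 / Real.Gamma (ν + 1) := by
      rw [besselSeries, tsum_eq_single 0]
      · simp
      · intro m hm; simp [hm]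
    rw [this]
    exact one_div_pos.mpr (Real.Gamma_pos_of_pos (by positivity))
  have hc : ContinuousAt (fun x : ℝ => besselSeries ν (x ^ 2 / 4)) 0 := by
    apply ContinuousAt.comp (g := besselSeries ν)
    · exact (hasDerivAt_besselSeries hν _).continuousAt
    · fun_prop
  have h1 : ∀ᶠ x in 𝓝 (0 : ℝ), 0 < besselSeries ν (x ^ 2 / 4) :=
    hc.eventually (lt_mem_nhds (by simpa using h0))
  filter_upwards [h1.filter_mono nhdsWithin_le_nhds, self_mem_nhdsWithin] with x hx hx0
  have hx0 : 0 < x := hx0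
  exact mul_pos (Real.rpow_pos_of_pos (by positivity) _) hx

/-! ### Poisson's integral -/

theorem continuous_one_sub_sq_rpow {a : ℝ} (ha : 0 ≤ a) :
    Continuous fun t : ℝ => (1 - t ^ 2) ^ a :=
  (continuous_const.sub (continuous_pow 2)).rpow_const fun _ => Or.inr ha

/-- The substitution t = 2x − 1 gives the Beta integral B(a + 1, a + 1); Legendre's duplication
formula simplifies it. -/
theorem integral_one_sub_sq_rpow {a : ℝ} (ha : 0 ≤ a) :
    ∫ t in (-1 : ℝ)..1, (1 - t ^ 2) ^ a =
      √Real.pi * Real.Gamma (a + 1) / Real.Gamma (a + 3 / 2) := by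
  have h1 : ∫ t in (-1 : ℝ)..1, (1 - t ^ 2) ^ a =
      2 * 4 ^ a * ∫ x in (0 : ℝ)..1, x ^ a * (1 - x) ^ a := by
    have := intervalIntegral.integral_comp_mul_sub (a := 0) (b := 1)
      (fun t : ℝ => (1 - t ^ 2) ^ a) (two_ne_zero' ℝ) 1
    norm_num at this
    rw [mul_assoc, ← intervalIntegral.integral_const_mul]
    have e : ∫ x in (0 : ℝ)..1, (1 - (2 * x - 1) ^ 2) ^ a =
        ∫ x in (0 : ℝ)..1, 4 ^ a * (x ^ a * (1 - x) ^ a) := by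
      refine intervalIntegral.integral_congr fun x hx => ?_
      rw [uIcc_of_le zero_le_one] at hx
      have : 0 ≤ 1 - x := by linarith [hx.2]
      rw [← Real.mul_rpow hx.1 this, ← Real.mul_rpow (by norm_num) (mul_nonneg hx.1 this)]
      congr 1
      ring
    rw [← e, this]
    ring
  have h2 : Complex.betaIntegral ((a + 1 : ℝ) : ℂ) ((a + 1 : ℝ) : ℂ) =
      ((∫ x in (0 : ℝ)..1, x ^ a * (1 - x) ^ a : ℝ) : ℂ) := by
    rw [Complex.betaIntegral, ← intervalIntegral.integral_ofReal]
    refine intervalIntegral.integral_congr fun x hx => ?_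
    rw [uIcc_of_le zero_le_one] at hx
    have : 0 ≤ 1 - x := by linarith [hx.2]
    push_cast
    rw [Complex.ofReal_cpow hx.1, Complex.ofReal_cpow this]
    simp
  have h3 := Complex.Gamma_mul_Gamma_eq_betaIntegral (s := ((a + 1 : ℝ) : ℂ))
    (t := ((a + 1 : ℝ) : ℂ)) (by rw [Complex.ofReal_re]; positivity)
    (by rw [Complex.ofReal_re]; positivity)
  rw [h2, ← Complex.ofReal_add, Complex.Gamma_ofReal, Complex.Gamma_ofReal] at h3
  norm_cast at h3
  have h4 := Real.Gamma_mul_Gamma_add_half (a + 1)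
  have g1 : 0 < Real.Gamma (a + 1) := Real.Gamma_pos_of_pos (by positivity)
  have g2 : 0 < Real.Gamma (a + 3 / 2) := Real.Gamma_pos_of_pos (by positivity)
  have g3 : 0 < Real.Gamma (2 * (a + 1)) := Real.Gamma_pos_of_pos (by positivity)
  rw [show a + 1 + 1 / 2 = a + 3 / 2 by ring] at h4
  rw [show a + 1 + (a + 1) = 2 * (a + 1) by ring] at h3
  have h5 : (2 : ℝ) ^ (1 - 2 * (a + 1)) * (2 * 4 ^ a) = 1 := by
    rw [show (4 : ℝ) = 2 ^ (2 : ℝ) by norm_num, ← Real.rpow_mul (by norm_num),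
      ← Real.rpow_one_add' (by norm_num) (by positivity), ← Real.rpow_add (by norm_num)]
    ring_nf
    simp
  rw [h1, eq_div_iff g2.ne']
  refine mul_left_cancel₀ (mul_pos g1 g3).ne' ?_
  set B := ∫ x in (0 : ℝ)..1, x ^ a * (1 - x) ^ a
  calc Real.Gamma (a + 1) * Real.Gamma (2 * (a + 1)) * (2 * 4 ^ a * B * Real.Gamma (a + 3 / 2))
      = (2 * 4 ^ a) * (Real.Gamma (2 * (a + 1)) * B) *
        (Real.Gamma (a + 1) * Real.Gamma (a + 3 / 2)) := by ring
    _ = (2 ^ (1 - 2 * (a + 1)) * (2 * 4 ^ a)) * (Real.Gamma (a + 1) * Real.Gamma (a + 1)) *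
        (Real.Gamma (2 * (a + 1)) * √Real.pi) := by rw [← h3, h4]; ring
    _ = _ := by rw [h5]; ring

/-- Integrate the derivative of (1 − t²)^(a+1) t^(2m+1), which vanishes at both ends. -/
theorem integral_one_sub_sq_rpow_mul_pow_succ {a : ℝ} (ha : 0 ≤ a) (m : ℕ) :
    (2 * m + 2 * a + 3) * ∫ t in (-1 : ℝ)..1, (1 - t ^ 2) ^ a * t ^ (2 * (m + 1)) =
      (2 * m + 1) * ∫ t in (-1 : ℝ)..1, (1 - t ^ 2) ^ a * t ^ (2 * m) := by
  have hcont := continuous_one_sub_sq_rpow ha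
  have hd : ∀ t ∈ uIcc (-1 : ℝ) 1, HasDerivAt (fun t : ℝ => (1 - t ^ 2) ^ (a + 1) * t ^ (2 * m + 1))
      ((2 * m + 1) * ((1 - t ^ 2) ^ a * t ^ (2 * m)) -
        (2 * m + 2 * a + 3) * ((1 - t ^ 2) ^ a * t ^ (2 * (m + 1)))) t := by
    intro t ht
    rw [uIcc_of_le (by norm_num)] at ht
    have h0 : 0 ≤ 1 - t ^ 2 := by nlinarith [ht.1, ht.2]
    have d1 := ((hasDerivAt_pow 2 t).const_sub 1).rpow_const (p := a + 1)
      (Or.inr (by linarith))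
    refine (d1.mul (hasDerivAt_pow (2 * m + 1) t)).congr_deriv ?_
    rw [Real.rpow_add_of_nonneg h0 ha zero_le_one]
    simp only [Real.rpow_one, add_sub_cancel_right, Nat.add_sub_cancel]
    push_cast
    ring
  have hi := intervalIntegral.integral_eq_sub_of_hasDerivAt hd
    (Continuous.intervalIntegrable (by fun_prop) _ _)
  rw [intervalIntegral.integral_sub (Continuous.intervalIntegrable (by fun_prop) _ _)
    (Continuous.intervalIntegrable (by fun_prop) _ _), intervalIntegral.integral_const_mul,
    intervalIntegral.integral_const_mul] at hi
  have h0 : (0 : ℝ) ^ (a + 1) = 0 := Real.zero_rpow (by positivity)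
  norm_num [h0] at hi
  linarith

theorem integral_one_sub_sq_rpow_mul_pow {a : ℝ} (ha : 0 ≤ a) (m : ℕ) :
    ∫ t in (-1 : ℝ)..1, (1 - t ^ 2) ^ a * t ^ (2 * m) =
      √Real.pi * Real.Gamma (a + 1) * (2 * m).factorial /
        (4 ^ m * m.factorial * Real.Gamma (m + (a + 1 / 2) + 1)) := by
  induction m with
  | zero =>
    simp only [mul_zero, pow_zero, mul_one, Nat.factorial_zero, Nat.cast_one, Nat.cast_zero,
      one_mul, zero_add]
    rw [integral_one_sub_sq_rpow ha, show a + 1 / 2 + 1 = a + 3 / 2 by ring]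
  | succ m ih =>
    have h := integral_one_sub_sq_rpow_mul_pow_succ ha m
    have hc : 0 < 2 * m + 2 * a + 3 := by positivity
    rw [← mul_right_inj' hc.ne', h, ih]
    have g : 0 < Real.Gamma (m + (a + 1 / 2) + 1) := Real.Gamma_pos_of_pos (by positivity)
    rw [show ((m + 1 : ℕ) : ℝ) + (a + 1 / 2) + 1 = (m + (a + 1 / 2) + 1) + 1 by push_cast; ring,
      Real.Gamma_add_one (s := m + (a + 1 / 2) + 1) (by positivity),
      show 2 * (m + 1) = 2 * m + 1 + 1 by ring, Nat.factorial_succ, Nat.factorial_succ,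
      Nat.factorial_succ]
    generalize Real.Gamma (m + (a + 1 / 2) + 1) = G at *
    have : (m : ℝ) + (a + 1 / 2) + 1 ≠ 0 := by positivity
    push_cast
    field_simp
    ring

theorem integral_one_sub_sq_rpow_mul_cos {a : ℝ} (ha : 0 ≤ a) (x : ℝ) :
    ∫ t in (-1 : ℝ)..1, (1 - t ^ 2) ^ a * Real.cos (x * t) =
      √Real.pi * Real.Gamma (a + 1) * besselSeries (a + 1 / 2) (x ^ 2 / 4) := by
  have hcont := continuous_one_sub_sq_rpow ha
  have hs : Summable fun n : ℕ => |x| ^ (2 * n) / (2 * n).factorial :=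
    (Real.hasSum_cosh |x|).summable
  have key := intervalIntegral.hasSum_integral_of_dominated_convergence
    (μ := MeasureTheory.volume) (a := -1) (b := 1)
    (F := fun (n : ℕ) t => (1 - t ^ 2) ^ a * ((-1) ^ n * (x * t) ^ (2 * n) / (2 * n).factorial))
    (f := fun t => (1 - t ^ 2) ^ a * Real.cos (x * t))
    (fun n _ => |x| ^ (2 * n) / (2 * n).factorial)
    (fun n => (by fun_prop : Continuous _).aestronglyMeasurable)
    (fun n => Eventually.of_forall fun t ht => ?_)
    (Eventually.of_forall fun t ht => hs) intervalIntegrable_const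
    (Eventually.of_forall fun t ht => (Real.hasSum_cos (x * t)).mul_left _)
  · rw [← key.tsum_eq, besselSeries, ← tsum_mul_left]
    refine tsum_congr fun m => ?_
    have e : ∀ t : ℝ, (1 - t ^ 2) ^ a * ((-1) ^ m * (x * t) ^ (2 * m) / (2 * m).factorial) =
        (-1) ^ m * x ^ (2 * m) / (2 * m).factorial * ((1 - t ^ 2) ^ a * t ^ (2 * m)) := fun t => by
      rw [mul_pow]
      ring
    simp_rw [e]
    rw [intervalIntegral.integral_const_mul, integral_one_sub_sq_rpow_mul_pow ha, div_pow,
      ← pow_mul]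
    have g : 0 < Real.Gamma (m + (a + 1 / 2) + 1) := Real.Gamma_pos_of_pos (by positivity)
    field_simp
  · rw [uIoc_of_le (by norm_num)] at ht
    have ht1 : |t| ≤ 1 := abs_le.mpr ⟨ht.1.le, ht.2⟩
    have h0 : 0 ≤ 1 - t ^ 2 := by nlinarith [ht.1, ht.2]
    rw [norm_mul, norm_div, norm_mul, norm_pow, norm_neg, norm_one, one_pow, one_mul, norm_pow,
      Real.norm_eq_abs (x * t), abs_mul, Real.norm_natCast, Real.norm_of_nonneg (by positivity)]
    calc (1 - t ^ 2) ^ a * ((|x| * |t|) ^ (2 * n) / (2 * n).factorial)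
        ≤ 1 * ((|x| * 1) ^ (2 * n) / (2 * n).factorial) := by
          gcongr
          exact Real.rpow_le_one h0 (by nlinarith [sq_nonneg t]) ha
      _ = _ := by rw [one_mul, mul_one]

theorem besselReal_eq_integral {ν : ℝ} (hν : 1 / 2 ≤ ν) (x : ℝ) :
    besselReal ν x = (x / 2) ^ ν / (√Real.pi * Real.Gamma (ν + 1 / 2)) *
      ∫ t in (-1 : ℝ)..1, (1 - t ^ 2) ^ (ν - 1 / 2) * Real.cos (x * t) := by
  rw [integral_one_sub_sq_rpow_mul_cos (by linarith), besselReal,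
    show ν - 1 / 2 + 1 = ν + 1 / 2 by ring, sub_add_cancel]
  have g : 0 < Real.Gamma (ν + 1 / 2) := Real.Gamma_pos_of_pos (by positivity)
  have : 0 < √Real.pi := Real.sqrt_pos.mpr Real.pi_pos
  field_simp

/-! ### The amplitude at infinity -/

theorem norm_integral_vertical_side_le {a ε x s : ℝ} (ha : 0 < a) (hε : 0 ≤ ε) (hx : 0 < x)
    {F : ℂ → ℂ} (hF : ∀ y ∈ Ioc 0 ε,
      ‖F (s + y * Complex.I)‖ ≤ y ^ a * (2 + ε) ^ a * Real.exp (-(x * y))) :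
    ‖∫ y in (0 : ℝ)..ε, F (s + y * Complex.I)‖ ≤
      (2 + ε) ^ a * ((1 / x) ^ (a + 1) * Real.Gamma (a + 1)) := by
  have hc : Continuous fun y : ℝ => y ^ a * (2 + ε) ^ a * Real.exp (-(x * y)) :=
    ((continuous_id.rpow_const fun _ => Or.inr ha.le).mul continuous_const).mul (by fun_prop)
  calc _ ≤ ∫ y in (0 : ℝ)..ε, y ^ a * (2 + ε) ^ a * Real.exp (-(x * y)) :=
        intervalIntegral.norm_integral_le_of_norm_le hε
          (Eventually.of_forall hF) (hc.intervalIntegrable _ _)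
    _ = (2 + ε) ^ a * ∫ y in Ioc (0 : ℝ) ε, y ^ (a + 1 - 1) * Real.exp (-(x * y)) := by
        rw [intervalIntegral.integral_of_le hε, ← MeasureTheory.integral_const_mul]
        congr 1
        ext y
        rw [add_sub_cancel_right]
        ring
    _ ≤ (2 + ε) ^ a * ∫ y in Ioi (0 : ℝ), y ^ (a + 1 - 1) * Real.exp (-(x * y)) := by
        refine mul_le_mul_of_nonneg_left ?_ (by positivity)
        refine MeasureTheory.setIntegral_mono_set ?_ ?_ Ioc_subset_Ioi_self.eventuallyLE
        -- A non-integrable function would have integral 0 by convention, contradicting the positive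
        -- Gamma value.
        · by_contra hni
          have h1 := Real.integral_rpow_mul_exp_neg_mul_Ioi (by positivity : 0 < a + 1) hx
          rw [MeasureTheory.integral_undef hni] at h1
          have : 0 < (1 / x) ^ (a + 1) * Real.Gamma (a + 1) :=
            mul_pos (by positivity) (Real.Gamma_pos_of_pos (by positivity))
          linarith
        · refine (MeasureTheory.ae_restrict_iff' measurableSet_Ioi).mpr
            (Eventually.of_forall fun y hy => ?_)
          have hy : 0 < y := hy
          simp only [Pi.zero_apply]
          positivity
    _ = _ := by rw [Real.integral_rpow_mul_exp_neg_mul_Ioi (by positivity) hx]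

/-- Cauchy's theorem for (1 − z²)^a e^(ixz) on the rectangle of height ε over [−1, 1]: each vertical
side gives a Gamma integral, and the top is exponentially small. Splitting the power as (1 − z)^a (1
+ z)^a keeps both bases in the closed right half-plane. -/
theorem abs_integral_one_sub_sq_rpow_mul_cos_le {a ε x : ℝ} (ha : 0 < a) (hε : 0 < ε)
    (hε1 : ε ≤ 1) (hx : 0 < x) :
    |∫ t in (-1 : ℝ)..1, (1 - t ^ 2) ^ a * Real.cos (x * t)| ≤
      2 * ((2 + ε) ^ a * ((1 / x) ^ (a + 1) * Real.Gamma (a + 1))) +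
        2 * 9 ^ a * Real.exp (-ε * x) := by
  set F : ℂ → ℂ := fun z =>
    (1 - z) ^ (a : ℂ) * (1 + z) ^ (a : ℂ) * Complex.exp (Complex.I * x * z) with hF
  have hnorm : ∀ z : ℂ, ‖F z‖ = ‖1 - z‖ ^ a * ‖1 + z‖ ^ a * Real.exp (-(x * z.im)) := fun z => by
    rw [hF]
    simp only
    rw [norm_mul, norm_mul, Complex.norm_cpow_real, Complex.norm_cpow_real, Complex.norm_exp]
    congr 2
    simp
  have hrect := Complex.integral_boundary_rect_eq_zero_of_continuousOn_of_differentiableOn F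
    (-1 : ℝ) ((1 : ℝ) + (ε : ℝ) * Complex.I) ?_ ?_
  rotate_left
  · intro z hz
    simp only [Complex.ofReal_re, Complex.ofReal_im, Complex.add_re, Complex.add_im,
      Complex.mul_re, Complex.mul_im, Complex.I_re, Complex.I_im, mul_zero, mul_one,
      add_zero, zero_add, sub_self] at hz
    rw [uIcc_of_le (by norm_num), uIcc_of_le hε.le] at hz
    have hz1 : z.re ∈ Icc (-1 : ℝ) 1 := hz.1
    apply ContinuousAt.continuousWithinAt
    refine ContinuousAt.mul (ContinuousAt.mul ?_ ?_) (by fun_prop)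
    · exact ContinuousAt.comp (g := fun w : ℂ => w ^ (a : ℂ)) (f := fun z => 1 - z)
        (Complex.continuousAt_cpow_const_of_re_pos
          (Or.inl (by simpa using hz1.2)) (by simpa using ha)) (by fun_prop)
    · exact ContinuousAt.comp (g := fun w : ℂ => w ^ (a : ℂ)) (f := fun z => 1 + z)
        (Complex.continuousAt_cpow_const_of_re_pos
          (Or.inl (by simp; linarith [hz1.1])) (by simpa using ha)) (by fun_prop)
  · intro z hz
    simp only [Complex.ofReal_re, Complex.ofReal_im, Complex.add_re, Complex.add_im,
      Complex.mul_re, Complex.mul_im, Complex.I_re, Complex.I_im, mul_zero, mul_one,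
      add_zero, zero_add, sub_self] at hz
    rw [min_eq_left (by norm_num), max_eq_right (by norm_num)] at hz
    have hz1 : z.re ∈ Ioo (-1 : ℝ) 1 := hz.1
    apply DifferentiableAt.differentiableWithinAt
    refine DifferentiableAt.mul (DifferentiableAt.mul ?_ ?_) (by fun_prop)
    · exact DifferentiableAt.cpow_const (by fun_prop)
        (Or.inl (by simpa using hz1.2))
    · exact DifferentiableAt.cpow_const (by fun_prop)
        (Or.inl (by simp; linarith [hz1.1]))
  simp only [Complex.ofReal_re, Complex.ofReal_im, Complex.add_re, Complex.add_im,
      Complex.mul_re, Complex.mul_im, Complex.I_re, Complex.I_im, mul_zero, mul_one, zero_mul,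
      add_zero, zero_add, sub_self, Complex.ofReal_zero, smul_eq_mul] at hrect
  have hside : ∀ s : ℝ, (s = 1 ∨ s = -1) →
      ‖∫ y in (0 : ℝ)..ε, F (s + y * Complex.I)‖ ≤
        (2 + ε) ^ a * ((1 / x) ^ (a + 1) * Real.Gamma (a + 1)) := by
    intro s hs
    refine norm_integral_vertical_side_le ha hε.le hx fun y hy => ?_
    rw [hnorm]
    have him : ((s : ℂ) + y * Complex.I).im = y := by simp
    rw [him]
    have hy0 : 0 ≤ y := hy.1.le
    have hbig : ‖(2 : ℂ) + y * Complex.I‖ ≤ 2 + ε ∧ ‖(2 : ℂ) - y * Complex.I‖ ≤ 2 + ε := by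
      constructor
      · refine (norm_add_le _ _).trans ?_
        simp only [Complex.norm_ofNat, norm_mul, Complex.norm_real, Complex.norm_I, mul_one,
          Real.norm_of_nonneg hy0]
        linarith [hy.2]
      · refine (norm_sub_le _ _).trans ?_
        simp only [Complex.norm_ofNat, norm_mul, Complex.norm_real, Complex.norm_I, mul_one,
          Real.norm_of_nonneg hy0]
        linarith [hy.2]
    have hsmall : ‖(y : ℂ) * Complex.I‖ = y := by
      rw [norm_mul, Complex.norm_I, mul_one, Complex.norm_real, Real.norm_of_nonneg hy0]
    rcases hs with rfl | rfl
    · rw [show (1 : ℂ) - ((1 : ℝ) + y * Complex.I) = -(y * Complex.I) by push_cast; ring,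
        show (1 : ℂ) + ((1 : ℝ) + y * Complex.I) = 2 + y * Complex.I by push_cast; ring,
        norm_neg, hsmall]
      gcongr
      exact hbig.1
    · rw [show (1 : ℂ) - ((-1 : ℝ) + y * Complex.I) = 2 - y * Complex.I by push_cast; ring,
        show (1 : ℂ) + ((-1 : ℝ) + y * Complex.I) = y * Complex.I by push_cast; ring, hsmall,
        mul_comm (y ^ a)]
      gcongr
      exact hbig.2
  have htop : ‖∫ t in (-1 : ℝ)..1, F (t + ε * Complex.I)‖ ≤ 2 * 9 ^ a * Real.exp (-ε * x) := by
    have := intervalIntegral.norm_integral_le_of_norm_le_const (a := -1) (b := 1)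
      (f := fun t : ℝ => F (t + ε * Complex.I)) (C := 9 ^ a * Real.exp (-ε * x)) fun t ht => ?_
    · refine this.trans (le_of_eq ?_)
      norm_num
      ring
    · rw [uIoc_of_le (by norm_num)] at ht
      rw [hnorm]
      have him : ((t : ℂ) + ε * Complex.I).im = ε := by simp
      have hle : ‖(t : ℂ) + ε * Complex.I‖ ≤ 2 := by
        refine (norm_add_le _ _).trans ?_
        rw [norm_mul, Complex.norm_I, mul_one, Complex.norm_real, Complex.norm_real,
          Real.norm_of_nonneg hε.le]
        have : ‖t‖ ≤ 1 := abs_le.mpr ⟨ht.1.le, ht.2⟩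
        linarith
      have h1 : ‖1 - ((t : ℂ) + ε * Complex.I)‖ ≤ 3 :=
        (norm_sub_le _ _).trans (by rw [norm_one]; linarith)
      have h2 : ‖1 + ((t : ℂ) + ε * Complex.I)‖ ≤ 3 :=
        (norm_add_le _ _).trans (by rw [norm_one]; linarith)
      rw [him, show (9 : ℝ) = 3 * 3 by norm_num, Real.mul_rpow (by norm_num) (by norm_num),
        show -(x * ε) = -ε * x by ring]
      gcongr
  have hre : ∫ t in (-1 : ℝ)..1, (1 - t ^ 2) ^ a * Real.cos (x * t) =
      (∫ t in (-1 : ℝ)..1, F t).re := by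
    have hcF : IntervalIntegrable (fun t : ℝ => F t) MeasureTheory.volume (-1) 1 := by
      apply ContinuousOn.intervalIntegrable
      intro t ht
      rw [uIcc_of_le (by norm_num)] at ht
      apply ContinuousAt.continuousWithinAt
      refine ContinuousAt.mul (ContinuousAt.mul ?_ ?_) (by fun_prop)
      · exact ContinuousAt.comp (g := fun w : ℂ => w ^ (a : ℂ)) (f := fun t : ℝ => 1 - (t : ℂ))
          (Complex.continuousAt_cpow_const_of_re_pos
            (Or.inl (by simpa using ht.2)) (by simpa using ha)) (by fun_prop)
      · exact ContinuousAt.comp (g := fun w : ℂ => w ^ (a : ℂ)) (f := fun t : ℝ => 1 + (t : ℂ))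
          (Complex.continuousAt_cpow_const_of_re_pos
            (Or.inl (by simp; linarith [ht.1])) (by simpa using ha)) (by fun_prop)
    have := Complex.reCLM.intervalIntegral_comp_comm hcF
    simp only [Complex.reCLM_apply] at this
    rw [← this]
    refine intervalIntegral.integral_congr fun t ht => ?_
    rw [uIcc_of_le (by norm_num)] at ht
    have h1 : 0 ≤ 1 - t := by linarith [ht.2]
    have h2 : 0 ≤ 1 + t := by linarith [ht.1]
    simp only [hF]
    rw [← Complex.ofReal_one, ← Complex.ofReal_sub, ← Complex.ofReal_add,
      ← Complex.ofReal_cpow h1, ← Complex.ofReal_cpow h2, ← Complex.ofReal_mul,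
      Complex.re_ofReal_mul, ← Real.mul_rpow h1 h2,
      show Complex.I * x * t = ((x * t : ℝ) : ℂ) * Complex.I by push_cast; ring,
      Complex.exp_ofReal_mul_I_re]
    ring_nf
  rw [hre]
  refine (Complex.abs_re_le_norm _).trans ?_
  have hr := hside 1 (Or.inl rfl)
  have hl := hside (-1) (Or.inr rfl)
  set A := ∫ t in (-1 : ℝ)..1, F t
  set T := ∫ t in (-1 : ℝ)..1, F (t + ε * Complex.I)
  set R := ∫ y in (0 : ℝ)..ε, F ((1 : ℝ) + y * Complex.I)
  set L := ∫ y in (0 : ℝ)..ε, F ((-1 : ℝ) + y * Complex.I)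
  have hA : A = T - Complex.I * R + Complex.I * L := by linear_combination hrect
  rw [hA]
  refine (norm_add_le _ _).trans ?_
  have := norm_sub_le T (Complex.I * R)
  rw [norm_mul, Complex.norm_I, one_mul] at this ⊢
  linarith

theorem eventually_sqrt_mul_abs_besselReal_le {ν C : ℝ} (hν : 1 ≤ ν) (hC : √(2 / Real.pi) < C) :
    ∀ᶠ x in atTop, √x * |besselReal ν x| ≤ C := by
  have hπ : 0 < √Real.pi := Real.sqrt_pos.mpr Real.pi_pos
  set a := ν - 1 / 2 with ha
  have ha0 : 0 < a := by rw [ha]; linarith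
  have g : 0 < Real.Gamma (a + 1) := Real.Gamma_pos_of_pos (by positivity)
  -- At ε = 0 the leading constant, from the two vertical sides, is exactly √(2/π).
  have hε : ∃ ε : ℝ, 0 < ε ∧ ε ≤ 1 ∧ 2 * (2 + ε) ^ a / (2 ^ ν * √Real.pi) < C := by
    have hc : ContinuousAt (fun ε : ℝ => 2 * (2 + ε) ^ a / (2 ^ ν * √Real.pi)) 0 := by
      refine ContinuousAt.div_const (continuousAt_const.mul ?_) _
      exact ContinuousAt.rpow_const (by fun_prop) (Or.inr ha0.le)
    have h0 : 2 * (2 + 0) ^ a / (2 ^ ν * √Real.pi) < C := by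
      convert hC using 1
      rw [add_zero, show ν = a + 1 / 2 by rw [ha]; ring, Real.rpow_add (by norm_num),
        ← Real.sqrt_eq_rpow, Real.sqrt_div (by norm_num)]
      have : 0 < (2 : ℝ) ^ a := by positivity
      field_simp
      rw [Real.sq_sqrt (by norm_num)]
    have h1 := (hc.eventually (gt_mem_nhds h0)).filter_mono
      (nhdsWithin_le_nhds (s := Ioi (0 : ℝ)))
    obtain ⟨ε, h2, h3⟩ := (h1.and (Ioc_mem_nhdsGT (zero_lt_one' ℝ))).exists
    exact ⟨ε, h3.1, h3.2, h2⟩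
  obtain ⟨ε, hε0, hε1, hεC⟩ := hε
  have ht : Tendsto (fun x : ℝ => 2 * (2 + ε) ^ a / (2 ^ ν * √Real.pi) +
      2 * 9 ^ a / (2 ^ ν * √Real.pi * Real.Gamma (a + 1)) * (x ^ (a + 1) * Real.exp (-ε * x)))
      atTop (𝓝 (2 * (2 + ε) ^ a / (2 ^ ν * √Real.pi) +
        2 * 9 ^ a / (2 ^ ν * √Real.pi * Real.Gamma (a + 1)) * 0)) :=
    ((tendsto_rpow_mul_exp_neg_mul_atTop_nhds_zero (a + 1) ε hε0).const_mul _).const_add _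
  rw [mul_zero, add_zero] at ht
  filter_upwards [ht.eventually (gt_mem_nhds hεC), eventually_gt_atTop 0] with x hx hx0
  refine le_trans ?_ hx.le
  rw [besselReal_eq_integral (by linarith), ← ha, abs_mul,
    abs_of_nonneg (by rw [show ν + 1 / 2 = a + 1 by rw [ha]; ring]; positivity),
    show ν + 1 / 2 = a + 1 by rw [ha]; ring]
  calc _ ≤ √x * ((x / 2) ^ ν / (√Real.pi * Real.Gamma (a + 1)) *
        (2 * ((2 + ε) ^ a * ((1 / x) ^ (a + 1) * Real.Gamma (a + 1))) +
        2 * 9 ^ a * Real.exp (-ε * x))) := by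
        gcongr
        exact abs_integral_one_sub_sq_rpow_mul_cos_le ha0 hε0 hε1 hx0
    _ = _ := by
        have e : x ^ (a + 1) = √x * x ^ ν := by
          rw [Real.sqrt_eq_rpow, ← Real.rpow_add hx0, ha]
          congr 1
          ring
        have h1 : 0 < x ^ ν := by positivity
        have h2 : 0 < √x := Real.sqrt_pos.mpr hx0
        rw [Real.div_rpow hx0.le (by norm_num), Real.div_rpow zero_le_one hx0.le, Real.one_rpow, e]
        field_simp

/-! ### The estimate for the real Bessel functions -/

theorem eventually_mul_sq_besselReal_le {ν : ℝ} (hν : ν = 0 ∨ 1 ≤ ν) :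
    ∀ᶠ x in atTop, x * besselReal ν x ^ 2 ≤ 13 / 20 := by
  have hC : √(2 / Real.pi) < 4 / 5 := by
    rw [Real.sqrt_lt' (by norm_num), div_lt_iff₀ Real.pi_pos]
    linarith [Real.pi_gt_d2]
  have hsq : ∀ x : ℝ, 0 < x → √x * |besselReal ν x| ≤ 403 / 500 →
      x * besselReal ν x ^ 2 ≤ 13 / 20 := fun x hx h => by
    have h1 : (√x * |besselReal ν x|) ^ 2 ≤ (403 / 500) ^ 2 := by gcongr
    rw [mul_pow, Real.sq_sqrt hx.le, sq_abs] at h1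
    linarith
  rcases hν with rfl | hν
  -- For ν = 0 the Poisson exponent −1/2 is negative, so J₀ = (2/x) J₁ − J₂ is used instead; x ≥ 300
  -- makes the J₁ term fit between 4/5 and 403/500.
  · filter_upwards [eventually_sqrt_mul_abs_besselReal_le le_rfl hC,
      eventually_sqrt_mul_abs_besselReal_le one_le_two hC, eventually_ge_atTop 300] with x h1 h2 hx
    have hx0 : 0 < x := by linarith
    refine hsq x hx0 ?_
    have hr := besselReal_recurrence le_rfl hx0
    norm_num at hr
    rw [eq_sub_of_add_eq hr]
    calc √x * |2 / x * besselReal 1 x - besselReal 2 x|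
        ≤ √x * (|2 / x * besselReal 1 x| + |besselReal 2 x|) := by gcongr; exact abs_sub _ _
      _ = 2 / x * (√x * |besselReal 1 x|) + √x * |besselReal 2 x| := by
          rw [abs_mul, abs_of_pos (by positivity : 0 < 2 / x)]
          ring
      _ ≤ 2 / 300 * (4 / 5) + 4 / 5 := by gcongr
      _ ≤ 403 / 500 := by norm_num
  · filter_upwards [eventually_sqrt_mul_abs_besselReal_le hν hC, eventually_gt_atTop 0] with x h hx
    exact hsq x hx (h.trans (by norm_num))

theorem mul_besselReal_pow_four_le {ν x : ℝ} (hν : ν = 0 ∨ 1 ≤ ν) (hx : 0 < x) :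
    x * (ν ^ (1 / 3 : ℝ) + |x - ν|) * besselReal ν x ^ 4 ≤ 1 := by
  have hlim := eventually_mul_sq_besselReal_le hν
  rcases hν with rfl | hν
  · have := (isBesselPair_besselReal le_rfl).sub_mul_pow_four_le le_rfl hlim hx
    rw [Real.zero_rpow (by norm_num), zero_add, sub_zero, abs_of_pos hx]
    nlinarith
  · have hν0 : 0 ≤ ν := by linarith
    have hcube : (ν ^ (1 / 3 : ℝ)) ^ 3 = ν := by
      rw [← Real.rpow_natCast, ← Real.rpow_mul hν0]
      norm_num
    have hpair := isBesselPair_besselReal hν0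
    have hc := continuous_besselReal hν0
    have hc1 := continuous_besselReal (by linarith : 0 ≤ ν + 1)
    have h0 := besselReal_zero (by linarith : 0 < ν)
    have hpos := eventually_besselReal_pos hν0
    have hp0 : ν * besselReal ν 0 - 0 * besselReal (ν + 1) 0 = 0 := by rw [h0]; ring
    rw [← hcube] at hpair
    have := hpair.mul_pow_four_le_one (Real.one_le_rpow hν (by norm_num))
      (by rw [hcube]; exact hc.continuousOn)
      (by rw [hcube]; exact (by fun_prop : Continuous _).continuousOn)
      (by rw [hcube]; exact h0) (by rw [hcube]; exact hp0) (by rw [hcube]; exact hpos)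
      (by rw [hcube]; exact hlim) hx
    rwa [hcube] at this

theorem abs_besselReal_le {ν x : ℝ} (hν : ν = 0 ∨ 1 ≤ ν) (hx : 0 < x) :
    |besselReal ν x| ≤
      1 / (x ^ (1 / 4 : ℝ) * (ν ^ (1 / 3 : ℝ) + |x - ν|) ^ (1 / 4 : ℝ)) := by
  have h := mul_besselReal_pow_four_le hν hx
  have hpos : 0 < ν ^ (1 / 3 : ℝ) + |x - ν| := by
    rcases hν with rfl | hν
    · rw [sub_zero, abs_of_pos hx]; positivity
    · positivity
  have h4 : ∀ y : ℝ, 0 ≤ y → (y ^ (1 / 4 : ℝ)) ^ 4 = y := fun y hy => by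
    rw [← Real.rpow_natCast, ← Real.rpow_mul hy]
    norm_num
  rw [le_div_iff₀ (by positivity)]
  refine le_of_pow_le_pow_left₀ four_ne_zero zero_le_one ?_
  rw [mul_pow, mul_pow, h4 x hx.le, h4 _ hpos.le, one_pow, (by decide : Even 4).pow_abs]
  linarith

/-! ### Comparison of the definitions -/

theorem ofReal_besselSeries_sq (ν t : ℝ) :
    ((besselSeries ν (t ^ 2 / 4) : ℝ) : ℂ) =
      ∑' m : ℕ, (-1) ^ m / (m.factorial * Complex.Gamma (m + ν + 1)) *
        ((t : ℂ) / 2) ^ (2 * m) := by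
  rw [besselSeries, Complex.ofReal_tsum]
  refine tsum_congr fun m => ?_
  rw [show (m : ℂ) + ν + 1 = ((m + ν + 1 : ℝ) : ℂ) by push_cast; rfl, Complex.Gamma_ofReal, pow_mul,
    div_pow (t : ℂ)]
  push_cast
  norm_num

theorem norm_besselJ (ν t : ℝ) : ‖besselJ ν t‖ = |besselReal ν (|t|)| := by
  rw [besselJ, ← ofReal_besselSeries_sq, norm_mul, Complex.norm_cpow_real, Complex.norm_real,
    besselReal, sq_abs, abs_mul, abs_of_nonneg (by positivity : 0 ≤ (|t| / 2) ^ ν), norm_div,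
    Complex.norm_real, Complex.norm_ofNat, Real.norm_eq_abs, Real.norm_eq_abs]

theorem integral_exp_I_mul_int (m : ℤ) :
    ∫ k in (0 : ℝ)..(2 * Real.pi), Complex.exp (Complex.I * m * k) =
      if m = 0 then 2 * Real.pi else 0 := by
  split_ifs with h
  · simp [h]
  · have hc : Complex.I * m ≠ 0 := mul_ne_zero Complex.I_ne_zero (by exact_mod_cast h)
    rw [integral_exp_mul_complex hc]
    have : Complex.exp (Complex.I * m * (2 * Real.pi : ℝ)) = 1 := by
      rw [← Complex.exp_int_mul_two_pi_mul_I m]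
      congr 1
      push_cast
      ring
    rw [this]
    simp

/-- With w = −it/2, the factor e^(−it cos k) is exp(w e^(ik)) exp(w e^(−ik)). Expand both
exponentials and integrate termwise: orthogonality keeps only the pairs (j, n + j). -/
theorem besselJInt_natCast (n : ℕ) (t : ℝ) :
    besselJInt n t = (((t / 2) ^ n * besselSeries n (t ^ 2 / 4) : ℝ) : ℂ) := by
  set w : ℂ := -Complex.I * t / 2 with hw
  set b : ℕ → ℝ := fun j => |t / 2| ^ j / j.factorial with hb
  have hbs : Summable b := Real.summable_pow_div_factorial _
  have hb0 : 0 ≤ b := fun j => by rw [hb]; positivity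
  have hwn : ‖w‖ = |t / 2| := by simp [hw, abs_div]
  have hbb : Summable fun q : ℕ × ℕ => b q.1 * b q.2 := hbs.mul_of_nonneg hbs hb0 hb0
  have hexp : ∀ z : ℂ, HasSum (fun j : ℕ => z ^ j / j.factorial) (Complex.exp z) := fun z => by
    rw [Complex.exp_eq_exp_ℂ]
    exact NormedSpace.expSeries_div_hasSum_exp z
  set F : ℕ × ℕ → ℝ → ℂ := fun q k =>
    w ^ q.1 / q.1.factorial * (w ^ q.2 / q.2.factorial) *
      Complex.exp (Complex.I * ((n + q.1 - q.2 : ℤ) : ℂ) * k) with hF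
  have key := intervalIntegral.hasSum_integral_of_dominated_convergence
    (μ := MeasureTheory.volume) (a := 0) (b := 2 * Real.pi) (F := F)
    (f := fun k => Complex.exp (Complex.I * n * k - Complex.I * t * Real.cos k))
    (fun q _ => b q.1 * b q.2)
    (fun q => (by fun_prop : Continuous (F q)).aestronglyMeasurable)
    (fun q => Eventually.of_forall fun k _ => ?_)
    (Eventually.of_forall fun k _ => hbb) intervalIntegrable_const
    (Eventually.of_forall fun k _ => ?_)
  · have hint : ∀ q : ℕ × ℕ, ∫ k in (0 : ℝ)..(2 * Real.pi), F q k =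
        w ^ q.1 / q.1.factorial * (w ^ q.2 / q.2.factorial) *
          (if (n + q.1 - q.2 : ℤ) = 0 then 2 * Real.pi else 0) := fun q => by
      rw [hF]
      simp only
      rw [intervalIntegral.integral_const_mul, integral_exp_I_mul_int]
    simp_rw [hint] at key
    have hinj : Function.Injective fun j : ℕ => (j, n + j) := fun i j h => (Prod.mk.inj h).1
    rw [← hinj.hasSum_iff] at key
    · have key' := key.mul_left (Complex.I ^ n / (2 * Real.pi))
      rw [besselJInt, zpow_natCast, Int.cast_natCast, ← key'.tsum_eq, besselSeries,
        Complex.ofReal_mul, Complex.ofReal_tsum, ← tsum_mul_left]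
      refine tsum_congr fun j => ?_
      have hG : Real.Gamma (j + n + 1) = (n + j).factorial := by
        rw [← Real.Gamma_nat_eq_factorial]
        congr 1
        push_cast
        ring
      have hI : Complex.I ^ n * (w ^ j * w ^ (n + j)) =
          (t / 2) ^ n * ((-1) ^ j * (t ^ 2 / 4) ^ j) := by
        have e1 : Complex.I * w = t / 2 := by
          rw [hw]; linear_combination (-(t : ℂ) / 2) * Complex.I_mul_I
        have e2 : w * w = -1 * (t ^ 2 / 4) := by
          rw [hw]; linear_combination ((t : ℂ) ^ 2 / 4) * Complex.I_mul_I
        rw [← e1, ← mul_pow, ← e2, mul_pow, mul_pow]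
        ring
      have hπ : (Real.pi : ℂ) ≠ 0 := Complex.ofReal_ne_zero.mpr Real.pi_ne_zero
      have hj : (j.factorial : ℂ) ≠ 0 := Nat.cast_ne_zero.mpr j.factorial_ne_zero
      have hnj : ((n + j).factorial : ℂ) ≠ 0 := Nat.cast_ne_zero.mpr (n + j).factorial_ne_zero
      have hif : (n + j - (n + j : ℕ) : ℤ) = 0 := by push_cast; ring
      simp only [Function.comp, hif, if_true, hG]
      push_cast
      calc _ = Complex.I ^ n * (w ^ j * w ^ (n + j)) / (j.factorial * (n + j).factorial) := by
            field_simp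
        _ = _ := by rw [hI]; ring
    · intro q hq
      rw [if_neg, Complex.ofReal_zero, mul_zero]
      intro h0
      refine hq ⟨q.1, Prod.ext rfl ?_⟩
      simp only
      omega
  · rw [hF]
    simp only
    rw [norm_mul, norm_mul, norm_div, norm_div, norm_pow, norm_pow, hwn, Complex.norm_natCast,
      Complex.norm_natCast,
      show Complex.I * ((n + q.1 - q.2 : ℤ) : ℂ) * k =
        (((n + q.1 - q.2 : ℤ) * k : ℝ) : ℂ) * Complex.I by push_cast; ring,
      Complex.norm_exp_ofReal_mul_I, mul_one]
  · have h1 := hexp (w * Complex.exp (Complex.I * k))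
    have h2 := hexp (w * Complex.exp (-(Complex.I * k)))
    have hs := summable_mul_of_summable_norm h1.summable.norm h2.summable.norm
    have h12 := (h1.mul h2 hs).mul_right (Complex.exp (Complex.I * n * k))
    have hterm : ∀ q : ℕ × ℕ, F q k =
        (w * Complex.exp (Complex.I * k)) ^ q.1 / q.1.factorial *
          ((w * Complex.exp (-(Complex.I * k))) ^ q.2 / q.2.factorial) *
          Complex.exp (Complex.I * n * k) := fun q => by
      rw [hF]
      simp only
      rw [mul_pow, mul_pow, ← Complex.exp_nat_mul, ← Complex.exp_nat_mul,
        show Complex.I * ((n + q.1 - q.2 : ℤ) : ℂ) * k =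
          q.1 * (Complex.I * k) + q.2 * -(Complex.I * k) + Complex.I * n * k by push_cast; ring,
        Complex.exp_add, Complex.exp_add]
      ring
    have hval : Complex.exp (Complex.I * n * k - Complex.I * t * Real.cos k) =
        Complex.exp (w * Complex.exp (Complex.I * k)) *
          Complex.exp (w * Complex.exp (-(Complex.I * k))) *
          Complex.exp (Complex.I * n * k) := by
      rw [← Complex.exp_add, ← Complex.exp_add, Complex.ofReal_cos, Complex.cos, hw]
      congr 1
      ring_nf
    simp_rw [hterm, hval]
    exact h12

/-- The reflection k ↦ 2π − k identifies the integrals, and the prefactors have equal modulus. -/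
theorem norm_besselJInt_neg (n : ℤ) (t : ℝ) : ‖besselJInt (-n) t‖ = ‖besselJInt n t‖ := by
  have h : ∫ k in (0 : ℝ)..(2 * Real.pi),
      Complex.exp (Complex.I * (-n : ℤ) * k - Complex.I * t * Real.cos k) =
      ∫ k in (0 : ℝ)..(2 * Real.pi),
        Complex.exp (Complex.I * n * k - Complex.I * t * Real.cos k) := by
    have := intervalIntegral.integral_comp_sub_left (a := 0) (b := 2 * Real.pi)
      (fun k : ℝ => Complex.exp (Complex.I * n * k - Complex.I * t * Real.cos k)) (2 * Real.pi)
    rw [sub_self, sub_zero] at this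
    rw [← this]
    refine intervalIntegral.integral_congr fun k _ => ?_
    rw [Real.cos_two_pi_sub, ← one_mul (Complex.exp (Complex.I * (-n : ℤ) * k - _)),
      ← Complex.exp_int_mul_two_pi_mul_I n, ← Complex.exp_add]
    congr 1
    push_cast
    ring
  rw [besselJInt, besselJInt, h, norm_mul, norm_mul, norm_div, norm_div, norm_zpow, norm_zpow,
    Complex.norm_I, one_zpow, one_zpow]

theorem norm_besselJInt (n : ℤ) (t : ℝ) : ‖besselJInt n t‖ = |besselReal (|(n : ℝ)|) (|t|)| := by
  have hnat : ∀ m : ℕ, ‖besselJInt m t‖ = |besselReal m (|t|)| := fun m => by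
    rw [besselJInt_natCast, Complex.norm_real, besselReal, sq_abs, Real.rpow_natCast, norm_mul,
      abs_mul, norm_pow, Real.norm_eq_abs, Real.norm_eq_abs, abs_div, abs_pow, abs_div, abs_abs]
  obtain ⟨m, rfl | rfl⟩ := n.eq_nat_or_neg
  · rw [hnat, Int.cast_natCast, Nat.abs_cast]
  · rw [norm_besselJInt_neg, hnat, Int.cast_neg, Int.cast_natCast, abs_neg, Nat.abs_cast]

theorem propositionA3 :
    (∀ (n : ℤ) (t : ℝ), 1 ≤ |t| →
      ‖besselJInt n t‖ ≤
        1 / (|t| ^ (1 / 4 : ℝ) *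
          (|(n : ℝ)| ^ (1 / 3 : ℝ) + |(|t| - |(n : ℝ)|)|) ^ (1 / 4 : ℝ))) ∧
    (∀ (ν t : ℝ), 1 ≤ ν → 1 ≤ |t| →
      ‖besselJ (ν : ℂ) (t : ℂ)‖ ≤
        1 / (|t| ^ (1 / 4 : ℝ) *
          (|ν| ^ (1 / 3 : ℝ) + |(|t| - |ν|)|) ^ (1 / 4 : ℝ))) := by
  refine ⟨fun n t ht => ?_, fun ν t hν ht => ?_⟩
  · rw [norm_besselJInt]
    refine abs_besselReal_le ?_ (by linarith)
    rcases eq_or_ne n 0 with rfl | hn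
    · simp
    · right
      exact_mod_cast Int.one_le_abs hn
  · rw [norm_besselJ, abs_of_nonneg (by linarith : 0 ≤ ν)]
    exact abs_besselReal_le (Or.inr hν) (by linarith)
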